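/- Let $\tau\in\mathbb C$ with $\operatorname{Im}\tau>0$ and let $$\theta_1(z|\tau)=-i\,e^{\frac14\pi i\tau}\sum_{k\in\mathbb Z}(-1)^k e^{(k^2+k)\pi i\tau}e^{(2k+1)\pi iz},$$ $$\vartheta_2(\tau)=\sum_{k\in\mathbb Z}e^{(k+\frac12)^2\pi i\tau},\qquad \vartheta_3(\tau)=\sum_{k\in\mathbb Z}e^{k^2\pi i\tau},\qquad \vartheta_4(\tau)=\sum_{k\in\mathbb Z}(-1)^ke^{k^2\pi i\tau}.$$ Let $\boldsymbol\eta(\tau)=e^{\frac{\pi i}{12}\tau}\prod_{k\ge1}(1-e^{2k\pi i\tau})$ be the Dedekind eta function and let $\eta(\tau)=\zeta(1|1,\tau)$ be the Weierstrass eta function, where $$\zeta(z|\omega,\omega')=\frac1z+\sum_{w\in(2\omega\mathbb Z+2\omega'\mathbb Z)\setminus\{0\}}\Big(\frac1{z-w}+\frac1w+\frac z{w^2}\Big)$$ is the Weierstrass zeta function with half-periods $\omega,\omega'$. Define integers $\mathfrak G_{m,n}$ for $m,n\in\mathbb Z$ by $\mathfrak G_{0,0}=1$, $\mathfrak G_{m,n}=0$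 if $m<0$ or $n<0$, and, for all other $(m,n)$, $$\mathfrak G_{m,n}=4(n-2m-1)\,\mathfrak G_{m,n-1}-4(m-2n-1)\,\mathfrak G_{m-1,n}-2(m+n-1)(2m+2n-1)\big(\mathfrak G_{m-2,n}+\mathfrak G_{m-1,n-1}+\mathfrak G_{m,n-2}\big).$$ **Theorem 3.6.** For all $z\in\mathbb C$ the function $\theta_1$ is the sum of an absolutely convergent power series $$\theta_1(z|\tau)=\sum_{k=0}^\infty C_k(\tau)z^{2k+1}=2\pi\boldsymbol\eta^3\Big\{z-2\eta z^3+\Big(2\eta^2-\frac{\pi^4}{180}\big(\vartheta_2^8+\vartheta_2^4\vartheta_4^4+\vartheta_4^8\big)\Big)z^5+\cdots\Big\},$$ whose coefficients are, for all $k\ge0$, $$C_k(\tau)=2\pi\,\frac{(4\pi i)^k}{(2k+1)!}\,\frac{d^k\boldsymbol\eta^3}{d\tau^k}(\tau)=2\pi\boldsymbol\eta^3\,(-2)^k\sum_{\nu=0}^k\Big(-\frac{\pi^2}6\Big)^{\nu}\frac{\eta^{k-\nu}\,\mathcal N_\nu(\vartheta)}{(k-\nu)!\,(2\nu+1)!},$$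 where for $\mathcal N_\nu(\vartheta)$ one may take any one of the three expressions (the (4,2)-, (3,4)- and (3,2)-representation) $$\sum_{s=0}^\nu\mathfrak G_{\nu-s,s}\,\vartheta_4^{4s}\vartheta_2^{4(\nu-s)},\qquad \sum_{s=0}^\nu(-1)^s\mathfrak G_{\nu-s,s}\,\vartheta_3^{4s}\vartheta_4^{4(\nu-s)},\qquad \sum_{s=0}^\nu(-1)^s\mathfrak G_{s,\nu-s}\,\vartheta_3^{4s}\vartheta_2^{4(\nu-s)}.$$ Moreover $\mathfrak G_{m,n}=(-1)^{m+n}\,\mathfrak G_{n,m}$ for all $m,n\in\mathbb Z$. -/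

import Mathlib

open Complex

noncomputable section

namespace JacobiPowerSeries

/-- The Jacobi theta function `θ₁(z|τ)`, by its canonical series. -/
def theta1 (z τ : ℂ) : ℂ :=
  -I * exp ((Real.pi : ℂ) * I * τ / 4) *
    ∑' k : ℤ, (-1 : ℂ) ^ k * exp (((k : ℂ) ^ 2 + k) * Real.pi * I * τ) *
      exp ((2 * (k : ℂ) + 1) * Real.pi * I * z)

/-- The theta constant `ϑ₂(τ)`. -/
def vartheta2 (τ : ℂ) : ℂ :=
  ∑' k : ℤ, exp (((k : ℂ) + 1 / 2) ^ 2 * Real.pi * I * τ)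

/-- The theta constant `ϑ₃(τ)`. -/
def vartheta3 (τ : ℂ) : ℂ :=
  ∑' k : ℤ, exp ((k : ℂ) ^ 2 * Real.pi * I * τ)

/-- The theta constant `ϑ₄(τ)`. -/
def vartheta4 (τ : ℂ) : ℂ :=
  ∑' k : ℤ, (-1 : ℂ) ^ k * exp ((k : ℂ) ^ 2 * Real.pi * I * τ)

/-- The Weierstrass zeta function `ζ(z|ω, ω')` with half-periods `ω`, `ω'`, that is, of the lattice
`2ωℤ + 2ω'ℤ`. -/
def weierstrassZeta (ω ω' z : ℂ) : ℂ :=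
  1 / z + ∑' p : ℤ × ℤ, if p = 0 then 0 else
    (1 / (z - (2 * p.1 * ω + 2 * p.2 * ω')) + 1 / (2 * p.1 * ω + 2 * p.2 * ω') +
      z / (2 * p.1 * ω + 2 * p.2 * ω') ^ 2)

/-- The Weierstrass eta function `η(τ) = ζ(1|1, τ)`; it is not the Dedekind eta function
`ModularForm.eta`. -/
def weierstrassEta (τ : ℂ) : ℂ := weierstrassZeta 1 τ 1

/-- The integral recurrence `𝔊_{m,n}` on `ℤ × ℤ`; it vanishes as soon as one index is negative. -/
def G (m n : ℤ) : ℤ :=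
  if m < 0 ∨ n < 0 then 0
  else if m = 0 ∧ n = 0 then 1
  else
    4 * (n - 2 * m - 1) * G m (n - 1) - 4 * (m - 2 * n - 1) * G (m - 1) n
      - 2 * (m + n - 1) * (2 * m + 2 * n - 1)
        * (G (m - 2) n + G (m - 1) (n - 1) + G m (n - 2))
termination_by (m + n).toNat
decreasing_by all_goals omega

theorem G_zero_zero : G 0 0 = 1 := by
  rw [G]; simp

theorem G_of_neg {m n : ℤ} (h : m < 0 ∨ n < 0) : G m n = 0 := by
  rw [G, if_pos h]

theorem G_rec {m n : ℤ} (h : ¬(m = 0 ∧ n = 0)) :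
    G m n = 4 * (n - 2 * m - 1) * G m (n - 1) - 4 * (m - 2 * n - 1) * G (m - 1) n
      - 2 * (m + n - 1) * (2 * m + 2 * n - 1)
        * (G (m - 2) n + G (m - 1) (n - 1) + G m (n - 2)) := by
  by_cases hneg : m < 0 ∨ n < 0
  · rw [G_of_neg hneg, G_of_neg (m := m) (n := n - 1) (by omega),
      G_of_neg (m := m - 1) (n := n) (by omega), G_of_neg (m := m - 2) (n := n) (by omega),
      G_of_neg (m := m - 1) (n := n - 1) (by omega), G_of_neg (m := m) (n := n - 2) (by omega)]
    simp
  · rw [G, if_neg hneg, if_neg h]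

/-- The polynomial `𝒩_ν(ϑ)` in its (4,2)-representation. -/
def N42 (ν : ℕ) (τ : ℂ) : ℂ :=
  ∑ s ∈ Finset.range (ν + 1),
    (G ((ν : ℤ) - s) s : ℂ) * vartheta4 τ ^ (4 * s) * vartheta2 τ ^ (4 * (ν - s))

/-- The polynomial `𝒩_ν(ϑ)` in its (3,4)-representation. -/
def N34 (ν : ℕ) (τ : ℂ) : ℂ :=
  ∑ s ∈ Finset.range (ν + 1),
    (-1 : ℂ) ^ s * (G ((ν : ℤ) - s) s : ℂ) * vartheta3 τ ^ (4 * s) * vartheta4 τ ^ (4 * (ν - s))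

/-- The polynomial `𝒩_ν(ϑ)` in its (3,2)-representation. -/
def N32 (ν : ℕ) (τ : ℂ) : ℂ :=
  ∑ s ∈ Finset.range (ν + 1),
    (-1 : ℂ) ^ s * (G s ((ν : ℤ) - s) : ℂ) * vartheta3 τ ^ (4 * s) * vartheta2 τ ^ (4 * (ν - s))

/-- The coefficient of `z ^ (2 * k + 1)` as an explicit polynomial in the Dedekind eta function,
the Weierstrass eta function and the theta constants, `N` being one of the three representations
of the polynomials `𝒩_ν(ϑ)`. -/
def explicitCoeff (N : ℕ → ℂ → ℂ) (k : ℕ) (τ : ℂ) : ℂ :=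
  2 * Real.pi * ModularForm.eta τ ^ 3 * ((-2 : ℂ) ^ k *
    ∑ ν ∈ Finset.range (k + 1), (-((Real.pi : ℂ) ^ 2 / 6)) ^ ν *
      (weierstrassEta τ ^ (k - ν) * N ν τ / ((k - ν).factorial * (2 * ν + 1).factorial)))

end JacobiPowerSeries

end

open Complex

noncomputable section

namespace JacobiPowerSeries

/-! Expanding the exponentials of `theta1` in powers of `z` and exchanging the sums gives the
moments `thetaMoment l` as coefficients. The reflection `n ↦ -1 - n` kills the even ones. By the
heat equation the odd ones are `τ`-derivatives of `thetaMoment 1`, which is `2 η ^ 3` (Dedekind) by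
Jacobi's derivative formula `thetaPrime_eq_eta`. This yields the derivative form of the coefficients
(`hasSum_theta1`).

The explicit form comes from a closed differential system. Put `X = ϑ₄ ^ 4`, `Y = ϑ₂ ^ 4`, `W = -ϑ₃
^ 4`, and let `E` be the Eisenstein series of weight two. Then `X + Y + W = 0`, and the derivatives
of `E`, `X`, `Y`, `W` are polynomials in these functions (`ramanujan_eisenE`, `defect_eq_zero`). The
recurrence for `G` says exactly that repeated differentiation of `η ^ 3` produces the polynomials
`NPoly` (`NPoly_succ_eq`, `hasDerivAt_coeffSum`). The system is invariant under the cyclic shift `X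
→ Y → W → X`, so the same polynomials may be evaluated at `(X, Y)`, `(W, X)` or `(Y, W)`; these are
the three representations.

The modular identities all follow from one principle: a symmetric combination is a cusp form for the
full modular group, hence zero below weight 12 and a multiple of `η ^ 24` in weight 12. Finally `E`
is a multiple of the Weierstrass eta function (`weierstrassEta_eq_E2`). -/

/-! ### The recurrence and its homogeneous polynomials -/

theorem G_symm (m n : ℤ) : G m n = ((m + n).negOnePow : ℤ) * G n m := by
  by_cases hneg : m < 0 ∨ n < 0
  · rw [G_of_neg hneg, G_of_neg hneg.symm, mul_zero]
  by_cases h0 : m = 0 ∧ n = 0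
  · obtain ⟨rfl, rfl⟩ := h0
    simp
  have h0' : ¬(n = 0 ∧ m = 0) := fun h => h0 h.symm
  -- Exchanging `m` and `n` swaps the first two terms of the recurrence and reverses their signs,
  -- matching the parity of `m + n - 1`; the last bracket is symmetric.
  rw [G_rec h0, G_rec h0', G_symm m (n - 1), G_symm (m - 1) n, G_symm (m - 2) n,
    G_symm (m - 1) (n - 1), G_symm m (n - 2)]
  have e1 : m + (n - 1) = m + n - 1 := by ring
  have e2 : m - 1 + n = m + n - 1 := by ring
  have e3 : m - 2 + n = m + n - 2 := by ring
  have e4 : m - 1 + (n - 1) = m + n - 2 := by ring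
  have e5 : m + (n - 2) = m + n - 2 := by ring
  have s1 : ((m + n - 1).negOnePow : ℤ) = -((m + n).negOnePow : ℤ) := by
    rw [Int.negOnePow_sub]; simp
  have s2 : ((m + n - 2).negOnePow : ℤ) = ((m + n).negOnePow : ℤ) := by
    rw [Int.negOnePow_sub]; simp [Int.negOnePow_even 2 (by decide)]
  rw [e1, e2, e3, e4, e5, s1, s2]
  ring
termination_by (m + n).toNat
decreasing_by all_goals omega

/-- The homogeneous polynomial `∑ 𝔊_{m,n} x ^ n y ^ m` over `m + n = ν`. -/
def NPoly (ν : ℕ) (x y : ℂ) : ℂ :=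
  ∑ p ∈ Finset.HasAntidiagonal.antidiagonal ν, (G p.1 p.2 : ℂ) * x ^ p.2 * y ^ p.1

theorem NPoly_zero (x y : ℂ) : NPoly 0 x y = 1 := by
  simp [NPoly, G_zero_zero]

theorem G_one_zero : G 1 0 = 0 := by
  rw [G_rec (by simp)]; simp [G_of_neg]

theorem G_zero_one : G 0 1 = 0 := by
  rw [G_rec (by simp)]; simp [G_of_neg]

theorem NPoly_one (x y : ℂ) : NPoly 1 x y = 0 := by
  simp [NPoly, Finset.Nat.antidiagonal_succ, G_one_zero, G_zero_one]

theorem sum_antidiagonal_succ_fst {f : ℕ → ℕ → ℂ} (k : ℕ) (h : f 0 (k + 1) = 0) :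
    ∑ p ∈ Finset.HasAntidiagonal.antidiagonal (k + 1), f p.1 p.2 =
      ∑ p ∈ Finset.HasAntidiagonal.antidiagonal k, f (p.1 + 1) p.2 := by
  rw [Finset.Nat.sum_antidiagonal_succ (f := fun p => f p.1 p.2)]
  simp [h]

theorem sum_antidiagonal_succ_snd {f : ℕ → ℕ → ℂ} (k : ℕ) (h : f (k + 1) 0 = 0) :
    ∑ p ∈ Finset.HasAntidiagonal.antidiagonal (k + 1), f p.1 p.2 =
      ∑ p ∈ Finset.HasAntidiagonal.antidiagonal k, f p.1 (p.2 + 1) := by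
  rw [Finset.Nat.sum_antidiagonal_succ' (f := fun p => f p.1 p.2)]
  simp [h]

/-- The value at `(x, y)` of the derivation `4 x (x + 2 y) ∂ₓ - 4 y (2 x + y) ∂_y` of `NPoly ν`. -/
def NDer (ν : ℕ) (x y : ℂ) : ℂ :=
  ∑ p ∈ Finset.HasAntidiagonal.antidiagonal ν, (G p.1 p.2 : ℂ) * x ^ p.2 * y ^ p.1 *
    (4 * p.2 * (x + 2 * y) - 4 * p.1 * (2 * x + y))

/-- The recurrence in generating form: after an index shift its first two terms have the
coefficients `4 (n - 2 m) x` and `4 (2 n - m) y`, which regroup into the weight in `NDer`. -/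
theorem NPoly_succ_eq (ν : ℕ) (x y : ℂ) : NPoly (ν + 1) x y =
    NDer ν x y - 2 * ν * (2 * ν + 1) * ∑ p ∈ Finset.HasAntidiagonal.antidiagonal (ν + 1),
      ((G (p.1 - 2) p.2 : ℂ) + G (p.1 - 1) (p.2 - 1) + G p.1 (p.2 - 2)) * x ^ p.2 * y ^ p.1 := by
  have key : ∀ p ∈ Finset.HasAntidiagonal.antidiagonal (ν + 1), (G p.1 p.2 : ℂ) * x ^ p.2 * y ^ p.1 =
      4 * ((p.2 : ℂ) - 2 * p.1 - 1) * G p.1 (p.2 - 1) * x ^ p.2 * y ^ p.1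
      + (-4 * ((p.1 : ℂ) - 2 * p.2 - 1) * G (p.1 - 1) p.2 * x ^ p.2 * y ^ p.1)
      - 2 * ν * (2 * ν + 1) * (((G (p.1 - 2) p.2 : ℂ) + G (p.1 - 1) (p.2 - 1) + G p.1 (p.2 - 2))
        * x ^ p.2 * y ^ p.1) := by
    rintro ⟨m, n⟩ hp
    have hp : m + n = ν + 1 := by simpa using hp
    have hc : (ν : ℂ) = m + n - 1 := by
      have : ((m + n : ℕ) : ℂ) = ((ν + 1 : ℕ) : ℂ) := by rw [hp]
      push_cast at this
      linear_combination -this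
    dsimp only
    rw [G_rec (m := m) (n := n) (by omega), hc]
    push_cast
    ring
  rw [NPoly, Finset.sum_congr rfl key, Finset.sum_sub_distrib, Finset.sum_add_distrib,
    ← Finset.mul_sum,
    sum_antidiagonal_succ_snd (f := fun m n =>
      4 * ((n : ℂ) - 2 * m - 1) * G m (n - 1) * x ^ n * y ^ m) ν (by simp [G_of_neg]),
    sum_antidiagonal_succ_fst (f := fun m n =>
      (-4 * ((m : ℂ) - 2 * n - 1) * G (m - 1) n * x ^ n * y ^ m)) ν (by simp [G_of_neg]),
    ← Finset.sum_add_distrib, NDer]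
  congr 1
  refine Finset.sum_congr rfl fun p _ => ?_
  push_cast
  simp only [add_sub_cancel_right]
  ring

/-- `G` vanishes at negative indices, so no boundary terms survive and the three index shifts are
multiplications by `y ^ 2`, `x y` and `x ^ 2`. -/
theorem sum_G_shift (ν : ℕ) (x y : ℂ) : ∑ p ∈ Finset.HasAntidiagonal.antidiagonal (ν + 2),
      ((G (p.1 - 2) p.2 : ℂ) + G (p.1 - 1) (p.2 - 1) + G p.1 (p.2 - 2)) * x ^ p.2 * y ^ p.1 =
    (x ^ 2 + x * y + y ^ 2) * NPoly ν x y := by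
  simp only [add_mul, Finset.sum_add_distrib]
  have h1 : ∑ p ∈ Finset.HasAntidiagonal.antidiagonal (ν + 2), (G (p.1 - 2) p.2 : ℂ) * x ^ p.2 * y ^ p.1 =
      y ^ 2 * NPoly ν x y := by
    rw [sum_antidiagonal_succ_fst (f := fun m n => (G (m - 2) n : ℂ) * x ^ n * y ^ m) (ν + 1)
        (by simp [G_of_neg]),
      sum_antidiagonal_succ_fst (f := fun m n => (G ((m + 1 : ℕ) - 2) n : ℂ) * x ^ n * y ^ (m + 1)) ν
        (by simp [G_of_neg]), NPoly, Finset.mul_sum]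
    refine Finset.sum_congr rfl fun p _ => ?_
    have : (((p.1 + 1 + 1 : ℕ) : ℤ) - 2) = p.1 := by push_cast; ring
    rw [this]; ring
  have h2 : ∑ p ∈ Finset.HasAntidiagonal.antidiagonal (ν + 2), (G (p.1 - 1) (p.2 - 1) : ℂ) * x ^ p.2 * y ^ p.1 =
      x * y * NPoly ν x y := by
    rw [sum_antidiagonal_succ_fst (f := fun m n => (G (m - 1) (n - 1) : ℂ) * x ^ n * y ^ m) (ν + 1)
        (by simp [G_of_neg]),
      sum_antidiagonal_succ_snd (f := fun m n => (G ((m + 1 : ℕ) - 1) (n - 1) : ℂ) * x ^ n *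
        y ^ (m + 1)) ν (by simp [G_of_neg]), NPoly, Finset.mul_sum]
    refine Finset.sum_congr rfl fun p _ => ?_
    push_cast
    simp only [add_sub_cancel_right]
    ring
  have h3 : ∑ p ∈ Finset.HasAntidiagonal.antidiagonal (ν + 2), (G p.1 (p.2 - 2) : ℂ) * x ^ p.2 * y ^ p.1 =
      x ^ 2 * NPoly ν x y := by
    rw [sum_antidiagonal_succ_snd (f := fun m n => (G m (n - 2) : ℂ) * x ^ n * y ^ m) (ν + 1)
        (by simp [G_of_neg]),
      sum_antidiagonal_succ_snd (f := fun m n => (G m ((n + 1 : ℕ) - 2) : ℂ) * x ^ (n + 1) * y ^ m) ν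
        (by simp [G_of_neg]), NPoly, Finset.mul_sum]
    refine Finset.sum_congr rfl fun p _ => ?_
    have : (((p.2 + 1 + 1 : ℕ) : ℤ) - 2) = p.2 := by push_cast; ring
    rw [this]; ring
  rw [h1, h2, h3]; ring

theorem NPoly_two (x y : ℂ) : NPoly 2 x y = -6 * (x ^ 2 + x * y + y ^ 2) := by
  have h : NDer 1 x y = 0 := by simp [NDer, Finset.Nat.antidiagonal_succ, G_one_zero, G_zero_one]
  rw [NPoly_succ_eq 1, sum_G_shift 0, NPoly_zero, h]
  push_cast
  ring

theorem sum_range_eq_NPoly (ν : ℕ) (x y : ℂ) :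
    ∑ s ∈ Finset.range (ν + 1), (G ((ν : ℤ) - s) s : ℂ) * x ^ s * y ^ (ν - s) = NPoly ν x y := by
  rw [NPoly, ← Finset.Nat.sum_antidiagonal_swap, Finset.Nat.sum_antidiagonal_eq_sum_range_succ_mk]
  refine Finset.sum_congr rfl fun s hs => ?_
  simp only [Prod.fst_swap, Prod.snd_swap]
  rw [Nat.cast_sub (by simpa [Nat.lt_succ_iff] using hs)]

theorem sum_range_swap_eq_NPoly (ν : ℕ) (x y : ℂ) :
    ∑ s ∈ Finset.range (ν + 1), (G s ((ν : ℤ) - s) : ℂ) * y ^ s * x ^ (ν - s) = NPoly ν x y := by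
  rw [NPoly, Finset.Nat.sum_antidiagonal_eq_sum_range_succ_mk]
  refine Finset.sum_congr rfl fun s hs => ?_
  rw [Nat.cast_sub (by simpa [Nat.lt_succ_iff] using hs)]
  ring

theorem N42_eq (ν : ℕ) (τ : ℂ) : N42 ν τ = NPoly ν (vartheta4 τ ^ 4) (vartheta2 τ ^ 4) := by
  simp only [← sum_range_eq_NPoly, N42, pow_mul]

/-- The signs `(-1) ^ s` are absorbed by the minus sign in `-ϑ₃ ^ 4`. -/
theorem N34_eq (ν : ℕ) (τ : ℂ) : N34 ν τ = NPoly ν (-vartheta3 τ ^ 4) (vartheta4 τ ^ 4) := by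
  simp only [← sum_range_eq_NPoly, N34, pow_mul, neg_pow (vartheta3 τ ^ 4)]
  exact Finset.sum_congr rfl fun s _ => by ring

theorem N32_eq (ν : ℕ) (τ : ℂ) : N32 ν τ = NPoly ν (vartheta2 τ ^ 4) (-vartheta3 τ ^ 4) := by
  simp only [← sum_range_swap_eq_NPoly, N32, pow_mul, neg_pow (vartheta3 τ ^ 4)]
  exact Finset.sum_congr rfl fun s _ => by ring

/-- The shift of a sequence by one index, beginning with `0`. -/
def shiftSeq (f : ℕ → ℂ) : ℕ → ℂ
  | 0 => 0
  | n + 1 => f n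

/-- The terms `(-2) ^ ν N_ν / (2 ν + 1)!`. -/
def nTerm (x y : ℂ) (ν : ℕ) : ℂ := (-2) ^ ν * NPoly ν x y / (2 * ν + 1).factorial

/-- The weighted sum `∑ E ^ j / j! · (-2) ^ ν N_ν / (2 ν + 1)!` over `j + ν = k`. -/
def coeffSum (k : ℕ) (E x y : ℂ) : ℂ :=
  ∑ p ∈ Finset.HasAntidiagonal.antidiagonal k, E ^ p.1 / p.1.factorial * nTerm x y p.2

/-- In a product of generating series, a factor of the variable may be attached to either series. -/
theorem sum_shiftSeq (k : ℕ) (e n : ℕ → ℂ) :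
    ∑ p ∈ Finset.HasAntidiagonal.antidiagonal k, shiftSeq e p.1 * n p.2 =
      ∑ p ∈ Finset.HasAntidiagonal.antidiagonal k, e p.1 * shiftSeq n p.2 := by
  rcases k with _ | k
  · simp [shiftSeq]
  · rw [sum_antidiagonal_succ_fst (f := fun i j => shiftSeq e i * n j) k (by simp [shiftSeq]),
      sum_antidiagonal_succ_snd (f := fun i j => e i * shiftSeq n j) k (by simp [shiftSeq])]
    rfl

/-- For `i + j = k + 1` the prefactor is `(2 (i + j) + 1) (2 (i + j)) = (4 i + 8 j + 2) i + (2 j +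
1) (2 j)`. The factors `i` and `j` allow an index shift down to `k`, and the two sums containing `Q`
cancel by `sum_shiftSeq`. -/
theorem coeffSum_identity (k : ℕ) (E Q : ℂ) (n : ℕ → ℂ) :
    ∑ p ∈ Finset.HasAntidiagonal.antidiagonal k,
      (4 * (E ^ 2 - Q) * shiftSeq (fun j => E ^ j / j.factorial) p.1 * n p.2 +
        E ^ p.1 / p.1.factorial * (8 * p.2 * E * n p.2 +
          (2 * p.2 + 3) * (2 * p.2 + 2) * n (p.2 + 1) + 4 * Q * shiftSeq n p.2)) =
    (2 * k + 3) * (2 * k + 2) * (∑ p ∈ Finset.HasAntidiagonal.antidiagonal (k + 1),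
        E ^ p.1 / p.1.factorial * n p.2) -
      6 * E * ∑ p ∈ Finset.HasAntidiagonal.antidiagonal k, E ^ p.1 / p.1.factorial * n p.2 := by
  have h1 : (2 * k + 3) * (2 * k + 2) * (∑ p ∈ Finset.HasAntidiagonal.antidiagonal (k + 1),
        E ^ p.1 / p.1.factorial * n p.2) =
      ∑ p ∈ Finset.HasAntidiagonal.antidiagonal (k + 1),
        (4 * (p.1 : ℂ) + 8 * p.2 + 2) * p.1 * (E ^ p.1 / p.1.factorial * n p.2) +
      ∑ p ∈ Finset.HasAntidiagonal.antidiagonal (k + 1),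
        (2 * (p.2 : ℂ) + 1) * (2 * p.2) * (E ^ p.1 / p.1.factorial * n p.2) := by
    rw [← Finset.sum_add_distrib, Finset.mul_sum]
    refine Finset.sum_congr rfl ?_
    rintro ⟨i, j⟩ hp
    have hp : i + j = k + 1 := by simpa using hp
    have hc : (k : ℂ) = i + j - 1 := by
      have : ((i + j : ℕ) : ℂ) = ((k + 1 : ℕ) : ℂ) := by rw [hp]
      push_cast at this
      linear_combination -this
    dsimp only
    rw [hc]
    ring
  rw [sum_antidiagonal_succ_fst (f := fun i j =>
      (4 * (i : ℂ) + 8 * j + 2) * i * (E ^ i / i.factorial * n j)) k (by simp),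
    sum_antidiagonal_succ_snd (f := fun i j =>
      (2 * (j : ℂ) + 1) * (2 * j) * (E ^ i / i.factorial * n j)) k (by simp)] at h1
  have h2 : ∑ p ∈ Finset.HasAntidiagonal.antidiagonal k,
      4 * Q * (shiftSeq (fun j => E ^ j / j.factorial) p.1 * n p.2) =
    ∑ p ∈ Finset.HasAntidiagonal.antidiagonal k,
      4 * Q * (E ^ p.1 / p.1.factorial * shiftSeq n p.2) := by
    rw [← Finset.mul_sum, ← Finset.mul_sum, sum_shiftSeq k (fun j => E ^ j / j.factorial)]
  rw [h1, Finset.mul_sum, ← Finset.sum_add_distrib, ← Finset.sum_sub_distrib, ← sub_eq_zero,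
    ← Finset.sum_sub_distrib]
  rw [eq_comm, ← sub_eq_zero, ← Finset.sum_sub_distrib] at h2
  refine Eq.trans (Finset.sum_congr rfl ?_) h2
  rintro ⟨i, j⟩ -
  rcases i with _ | i
  · simp only [shiftSeq]
    simp
    ring
  · have f0 : (i.factorial : ℂ) ≠ 0 := Nat.cast_ne_zero.2 i.factorial_ne_zero
    have n1 : (i + 1 : ℂ) ≠ 0 := by exact_mod_cast i.succ_ne_zero
    have n2 : (i + 1 + 1 : ℂ) ≠ 0 := by exact_mod_cast (i + 1).succ_ne_zero
    simp only [shiftSeq, Nat.factorial_succ]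
    push_cast
    field_simp
    ring

/-! ### Differentiation along the quadratic system -/

section ODE

variable {E x y : ℂ → ℂ} {c τ : ℂ}

/-- The `E`-part of the vector field is `8 E` times the Euler field, which acts on degree `ν` as
multiplication by `ν`; the rest is `-2` times the derivation behind `NDer`. -/
theorem hasDerivAt_NPoly (ν : ℕ)
    (hx : HasDerivAt x (c * (8 * x τ * (E τ - x τ - 2 * y τ))) τ)
    (hy : HasDerivAt y (c * (8 * y τ * (E τ + 2 * x τ + y τ))) τ) :
    HasDerivAt (fun t => NPoly ν (x t) (y t))
      (c * (8 * ν * E τ * NPoly ν (x τ) (y τ) - 2 * NDer ν (x τ) (y τ))) τ := by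
  have h : ∀ p ∈ Finset.HasAntidiagonal.antidiagonal ν, HasDerivAt
      (fun t => (G p.1 p.2 : ℂ) * x t ^ p.2 * y t ^ p.1)
      (c * (8 * ν * E τ * ((G p.1 p.2 : ℂ) * x τ ^ p.2 * y τ ^ p.1) -
        2 * ((G p.1 p.2 : ℂ) * x τ ^ p.2 * y τ ^ p.1 *
    (4 * p.2 * (x τ + 2 * y τ) - 4 * p.1 * (2 * x τ + y τ))))) τ := by
    rintro ⟨m, n⟩ hp
    have hp : m + n = ν := by simpa using hp
    subst hp
    dsimp only
    refine (((hx.fun_pow n).const_mul (G m n : ℂ)).mul (hy.fun_pow m)).congr_deriv ?_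
    -- The truncated exponent `m - 1` is harmless at `m = 0` because of the factor `m`.
    have hm : (m : ℂ) * y τ ^ (m - 1) * y τ = m * y τ ^ m := by
      rcases m with _ | m <;> simp [pow_succ, mul_assoc]
    have hn : (n : ℂ) * x τ ^ (n - 1) * x τ = n * x τ ^ n := by
      rcases n with _ | n <;> simp [pow_succ, mul_assoc]
    push_cast
    linear_combination (8 * c * (E τ - x τ - 2 * y τ) * G m n * y τ ^ m) * hn +
      (8 * c * (E τ + 2 * x τ + y τ) * G m n * x τ ^ n) * hm
  have := HasDerivAt.fun_sum h
  simpa only [NPoly, NDer, Finset.mul_sum, Finset.sum_sub_distrib, mul_sub] using this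

theorem NDer_eq (ν : ℕ) (x y : ℂ) :
    NDer (ν + 1) x y = NPoly (ν + 2) x y +
      2 * (ν + 1) * (2 * (ν + 1) + 1) * (x ^ 2 + x * y + y ^ 2) * NPoly ν x y := by
  have := NPoly_succ_eq (ν + 1) x y
  rw [sum_G_shift] at this
  rw [this]; push_cast; ring

theorem NDer_zero (x y : ℂ) : NDer 0 x y = 0 := by simp [NDer]

/-- `NDer_eq` trades the derivation for the neighbours of index `ν + 1` and `ν - 1`; the
normalisation `(-2) ^ ν / (2 ν + 1)!` makes their coefficients polynomial. At `ν = 0` the term of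
index `1` drops out because `NPoly 1 = 0`. -/
theorem hasDerivAt_nTerm (ν : ℕ)
    (hx : HasDerivAt x (c * (8 * x τ * (E τ - x τ - 2 * y τ))) τ)
    (hy : HasDerivAt y (c * (8 * y τ * (E τ + 2 * x τ + y τ))) τ) :
    HasDerivAt (fun t => nTerm (x t) (y t) ν)
      (c * (8 * ν * E τ * nTerm (x τ) (y τ) ν +
        (2 * ν + 3) * (2 * ν + 2) * nTerm (x τ) (y τ) (ν + 1) +
        4 * (x τ ^ 2 + x τ * y τ + y τ ^ 2) * shiftSeq (nTerm (x τ) (y τ)) ν)) τ := by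
  refine (((hasDerivAt_NPoly ν hx hy).const_mul ((-2) ^ ν)).div_const
    ((2 * ν + 1).factorial : ℂ)).congr_deriv ?_
  have f0 : ∀ n : ℕ, (n.factorial : ℂ) ≠ 0 := fun n => Nat.cast_ne_zero.2 n.factorial_ne_zero
  rcases ν with _ | ν
  · simp only [NDer_zero, nTerm, shiftSeq, zero_add, NPoly_one]
    simp
  · have e1 : ((2 * (ν + 1 + 1) + 1).factorial : ℂ) =
        (2 * ν + 5) * (2 * ν + 4) * (2 * (ν + 1) + 1).factorial := by
      rw [show 2 * (ν + 1 + 1) + 1 = 2 * (ν + 1) + 1 + 1 + 1 by ring, Nat.factorial_succ,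
        Nat.factorial_succ (2 * (ν + 1) + 1)]
      push_cast; ring
    have e2 : ((2 * (ν + 1) + 1).factorial : ℂ) =
        (2 * ν + 3) * (2 * ν + 2) * (2 * ν + 1).factorial := by
      rw [show 2 * (ν + 1) + 1 = 2 * ν + 1 + 1 + 1 by ring, Nat.factorial_succ,
        Nat.factorial_succ (2 * ν + 1)]
      push_cast; ring
    have n2 : (2 * ν + 2 : ℂ) ≠ 0 := by exact_mod_cast (by omega : 2 * ν + 2 ≠ 0)
    have n3 : (2 * ν + 3 : ℂ) ≠ 0 := by exact_mod_cast (by omega : 2 * ν + 3 ≠ 0)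
    have n4 : (2 * ν + 4 : ℂ) ≠ 0 := by exact_mod_cast (by omega : 2 * ν + 4 ≠ 0)
    have n5 : (2 * ν + 5 : ℂ) ≠ 0 := by exact_mod_cast (by omega : 2 * ν + 5 ≠ 0)
    simp only [NDer_eq, nTerm, shiftSeq]
    rw [e1, e2]
    have := f0 (2 * ν + 1)
    push_cast
    field_simp
    ring

/-- With `c = π i / 24` the term `-6 E` is cancelled by the logarithmic derivative of `η ^ 3`, which
is `6 c E`. -/
theorem hasDerivAt_coeffSum (k : ℕ)
    (hE : HasDerivAt E (c * (4 * (E τ ^ 2 - (x τ ^ 2 + x τ * y τ + y τ ^ 2)))) τ)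
    (hx : HasDerivAt x (c * (8 * x τ * (E τ - x τ - 2 * y τ))) τ)
    (hy : HasDerivAt y (c * (8 * y τ * (E τ + 2 * x τ + y τ))) τ) :
    HasDerivAt (fun t => coeffSum k (E t) (x t) (y t))
      (c * ((2 * k + 3) * (2 * k + 2) * coeffSum (k + 1) (E τ) (x τ) (y τ) -
        6 * E τ * coeffSum k (E τ) (x τ) (y τ))) τ := by
  have he : ∀ j : ℕ, HasDerivAt (fun t => E t ^ j / j.factorial)
      (c * (4 * (E τ ^ 2 - (x τ ^ 2 + x τ * y τ + y τ ^ 2)) *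
        shiftSeq (fun j => E τ ^ j / j.factorial) j)) τ := by
    intro j
    refine ((hE.fun_pow j).div_const (j.factorial : ℂ)).congr_deriv ?_
    rcases j with _ | j
    · simp [shiftSeq]
    · have f0 : (j.factorial : ℂ) ≠ 0 := Nat.cast_ne_zero.2 j.factorial_ne_zero
      have n1 : (j + 1 : ℂ) ≠ 0 := by exact_mod_cast j.succ_ne_zero
      simp only [shiftSeq, Nat.factorial_succ, add_tsub_cancel_right]
      push_cast
      field_simp
  have h := HasDerivAt.fun_sum (u := Finset.HasAntidiagonal.antidiagonal k)
    fun p _ => (he p.1).mul (hasDerivAt_nTerm (E := E) p.2 hx hy)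
  refine h.congr_deriv ?_
  simp only [coeffSum]
  rw [← coeffSum_identity k (E τ) (x τ ^ 2 + x τ * y τ + y τ ^ 2), Finset.mul_sum]
  exact Finset.sum_congr rfl fun p _ => by ring

end ODE

/-! ### The Weierstrass eta function and the Eisenstein series of weight two -/

section WeierstrassEta

open Filter Topology SummationFilter EisensteinSeries


/-- A telescoping series over `ℤ` which converges unconditionally has sum zero if its
terms come from a sequence vanishing at both ends. -/
theorem tsum_telescope_int {h : ℤ → ℂ} (hs : Summable fun m => h m - h (m + 1))
    (htop : Tendsto (fun N : ℕ => h N) atTop (𝓝 0))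
    (hbot : Tendsto (fun N : ℕ => h (-N)) atTop (𝓝 0)) :
    ∑' m, (h m - h (m + 1)) = 0 := by
  have h1 : Tendsto (fun N : ℕ => ∑ m ∈ Finset.Ico (-(N : ℤ)) N, (h m - h (m + 1))) atTop
      (𝓝 (∑' m, (h m - h (m + 1)))) := by
    have := hs.hasSum
    rw [HasSum, unconditional_filter] at this
    exact this.comp Finset.tendsto_Ico_neg
  have h2 := hbot.sub htop
  simp only [sub_zero, ← Finset.sum_Ico_int_sub] at h2
  exact tendsto_nhds_unique h1 h2

/-- The lattice points `2 m + 2 n τ`. -/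
def latticePt (τ : ℂ) (n m : ℤ) : ℂ := 2 * m + 2 * n * τ

/-- The summand of the Weierstrass zeta function at `1`. With the convention `1 / 0 = 0` its value
at the origin is the contribution `1` of the pole. -/
def zetaTerm (τ : ℂ) (n m : ℤ) : ℂ :=
  1 / (1 - latticePt τ n m) + 1 / latticePt τ n m + 1 / latticePt τ n m ^ 2

variable {τ : ℂ}

theorem latticePt_ne_zero (hτ : 0 < τ.im) {n m : ℤ} (h : ¬(n = 0 ∧ m = 0)) :
    latticePt τ n m ≠ 0 := by
  intro h0
  have him := congrArg Complex.im h0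
  have hn : n = 0 := by simpa [latticePt, hτ.ne'] using him
  subst hn
  have hm : m = 0 := by simpa [latticePt] using h0
  exact h ⟨rfl, hm⟩

theorem one_sub_latticePt_ne_zero (hτ : 0 < τ.im) (n m : ℤ) : 1 - latticePt τ n m ≠ 0 := by
  intro h0
  have him := congrArg Complex.im h0
  have hn : n = 0 := by simpa [latticePt, hτ.ne'] using him
  subst hn
  have : ((1 - 2 * m : ℤ) : ℂ) = 0 := by simpa [latticePt] using h0
  have : 1 - 2 * m = 0 := by exact_mod_cast this
  omega

theorem summable_inv_sq_mul_add_one (z : UpperHalfPlane) : Summable fun m : Fin 2 → ℤ =>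
    (((m 0 : ℂ) * z + m 1) ^ 2 * (m 0 * z + m 1 + 1))⁻¹ := by
  apply summable_of_isBigO_rpow_norm (a := 3) (by linarith)
  simpa [pow_three, pow_two, ← mul_assoc] using ((isBigO_linear_add_const_vec z 0 1).mul
    (isBigO_linear_add_const_vec z 0 0)).mul (isBigO_linear_add_const_vec z 0 0)

/-- Away from the origin, `1 / (1 - w) + 1 / w + 1 / w ^ 2 = 1 / (w ^ 2 (1 - w))`, which decays
cubically on a planar lattice. -/
theorem summable_zetaTerm (hτ : 0 < τ.im) : Summable fun p : ℤ × ℤ => zetaTerm τ p.1 p.2 := by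
  have hi : Function.Injective fun p : ℤ × ℤ => (![-2 * p.1, -2 * p.2] : Fin 2 → ℤ) := by
    rintro ⟨a, b⟩ ⟨c, d⟩ h
    have h0 := congrFun h 0
    have h1 := congrFun h 1
    simp at h0 h1
    simp [h0, h1]
  have h := (summable_inv_sq_mul_add_one ⟨τ, hτ⟩).comp_injective hi
  refine h.congr_cofinite ?_
  filter_upwards [eventually_cofinite_ne (0, 0)] with p hp
  have hW := latticePt_ne_zero hτ (n := p.1) (m := p.2) (fun hh => hp (Prod.ext hh.1 hh.2))
  have hW' := one_sub_latticePt_ne_zero hτ p.1 p.2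
  have e : ((-2 * p.1 : ℤ) : ℂ) * τ + ((-2 * p.2 : ℤ) : ℂ) = -latticePt τ p.1 p.2 := by
    simp only [latticePt]; push_cast; ring
  simp only [Function.comp, Matrix.cons_val_zero, Matrix.cons_val_one, zetaTerm]
  rw [e]
  have hW'' : -latticePt τ p.1 p.2 + 1 ≠ 0 := by rwa [neg_add_eq_sub]
  field_simp
  ring

theorem weierstrassEta_eq_tsum (hτ : 0 < τ.im) :
    weierstrassEta τ = ∑' p : ℤ × ℤ, zetaTerm τ p.1 p.2 := by
  have hs : Summable fun p : ℤ × ℤ => zetaTerm τ p.2 p.1 :=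
    (summable_zetaTerm hτ).prod_symm
  have h0 : zetaTerm τ 0 0 = 1 := by simp [zetaTerm, latticePt]
  -- The definition lists the multiple of the period `2` first, `zetaTerm` the multiple of `2 τ`.
  rw [← (Equiv.prodComm ℤ ℤ).tsum_eq, weierstrassEta, weierstrassZeta]
  change _ = ∑' p : ℤ × ℤ, zetaTerm τ p.2 p.1
  rw [hs.tsum_eq_add_tsum_ite 0]
  congr 1
  · simp [h0]
  · refine tsum_congr fun p => ?_
    split_ifs
    · rfl
    · simp only [zetaTerm, latticePt, mul_one]

/-- The odd part of the row sums of the Weierstrass zeta function at `1`. -/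
def rowDefect (τ : ℂ) (n : ℤ) : ℂ := ∑' m, (1 / (1 - latticePt τ n m) + 1 / latticePt τ n m)

theorem one_div_latticePt_sq (hτ : 0 < τ.im) (n m : ℤ) :
    1 / latticePt τ n m ^ 2 = 1 / 4 * eisSummand 2 ![n, m] ⟨τ, hτ⟩ := by
  have : latticePt τ n m = 2 * (n * τ + m) := by rw [latticePt]; ring
  rw [this, mul_pow, one_div, mul_inv]
  simp only [eisSummand, Matrix.cons_val_zero, Matrix.cons_val_one]
  norm_num [zpow_neg]

theorem summable_rowDefect (hτ : 0 < τ.im) (n : ℤ) :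
    Summable fun m => 1 / (1 - latticePt τ n m) + 1 / latticePt τ n m := by
  have h1 : Summable fun m => zetaTerm τ n m := (summable_zetaTerm hτ).prod_factor n
  have h2 := (e2Summand_summable n ⟨τ, hτ⟩).mul_left (1 / 4)
  refine (h1.sub h2).congr fun m => ?_
  rw [← one_div_latticePt_sq, zetaTerm]
  ring

theorem tsum_zetaTerm (hτ : 0 < τ.im) (n : ℤ) :
    ∑' m, zetaTerm τ n m = 1 / 4 * e2Summand n ⟨τ, hτ⟩ + rowDefect τ n := by
  rw [rowDefect, e2Summand, ← tsum_mul_left, ← Summable.tsum_add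
    ((e2Summand_summable n ⟨τ, hτ⟩).mul_left (1 / 4)) (summable_rowDefect hτ n)]
  refine tsum_congr fun m => ?_
  rw [← one_div_latticePt_sq, zetaTerm]
  ring

/-- After `m ↦ -m` in one row, the sum of the rows `n` and `-n` has terms `1 / (1 + w) + 1 / (1 -
w)`. Since `1 - (w + 2) = -(1 + w)`, this telescopes. -/
theorem rowDefect_neg (hτ : 0 < τ.im) (n : ℤ) : rowDefect τ (-n) = -rowDefect τ n := by
  have hneg : ∀ m, latticePt τ (-n) (-m) = -latticePt τ n m := fun m => by
    simp only [latticePt]; push_cast; ring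
  have hs := summable_rowDefect hτ n
  have hs' := (Equiv.neg ℤ).summable_iff.2 (summable_rowDefect hτ (-n))
  have e : rowDefect τ (-n) =
      ∑' m, (1 / (1 + latticePt τ n m) - 1 / latticePt τ n m) := by
    rw [rowDefect, ← (Equiv.neg ℤ).tsum_eq]
    refine tsum_congr fun m => ?_
    simp only [Equiv.neg_apply, hneg, sub_neg_eq_add, one_div, inv_neg]
    ring
  have hs'' : Summable fun m => 1 / (1 + latticePt τ n m) - 1 / latticePt τ n m := by
    refine hs'.congr fun m => ?_
    simp only [Function.comp, Equiv.neg_apply, hneg, sub_neg_eq_add, one_div, inv_neg]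
    ring
  rw [eq_neg_iff_add_eq_zero, e, rowDefect, ← Summable.tsum_add hs'' hs]
  have hterm : ∀ m, 1 / (1 + latticePt τ n m) - 1 / latticePt τ n m +
      (1 / (1 - latticePt τ n m) + 1 / latticePt τ n m) =
      1 / (1 - latticePt τ n m) - 1 / (1 - latticePt τ n (m + 1)) := fun m => by
    have : 1 - latticePt τ n (m + 1) = -(1 + latticePt τ n m) := by
      simp only [latticePt]; push_cast; ring
    rw [this, one_div (-_), inv_neg]
    ring
  have hlim : ∀ a : ℤ, a ≠ 0 →
      Tendsto (fun N : ℕ => 1 / (1 - latticePt τ n (a * N))) atTop (𝓝 0) := by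
    intro a ha
    simp only [one_div]
    refine tendsto_inv₀_cobounded.comp ?_
    have h1 : Tendsto (fun N : ℕ => (-(2 * a) : ℂ) * N) atTop (Bornology.cobounded ℂ) :=
      (tendsto_mul_left_cobounded (by simpa using ha)).comp tendsto_natCast_atTop_cobounded
    have h2 := tendsto_const_add_cobounded (1 - 2 * n * τ : ℂ) |>.comp h1
    refine h2.congr fun N => ?_
    simp only [latticePt, Function.comp]
    push_cast
    ring
  simp only [hterm]
  refine tsum_telescope_int ((hs''.add hs).congr hterm) ?_ ?_
  · simpa using hlim 1 (by norm_num)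
  · simpa using hlim (-1) (by norm_num)

/-- The double series is summed by rows. The rows of `G2` are summed over symmetric intervals, where
the odd function `rowDefect` cancels. The constant is `1 / 4 · 2 ζ(2) = π ^ 2 / 12`. -/
theorem weierstrassEta_eq_E2 (hτ : 0 < τ.im) :
    weierstrassEta τ = (Real.pi : ℂ) ^ 2 / 12 * E2 ⟨τ, hτ⟩ := by
  have h1 := (summable_zetaTerm hτ).hasSum.prod_fiberwise fun n =>
    ((summable_zetaTerm hτ).prod_factor n).hasSum
  rw [← weierstrassEta_eq_tsum hτ] at h1
  simp only [tsum_zetaTerm hτ] at h1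
  have h2 : HasSum (fun n => 1 / 4 * e2Summand n ⟨τ, hτ⟩ + rowDefect τ n) (weierstrassEta τ)
      (symmetricIcc ℤ) := h1.mono_left (symmetricIcc ℤ).le_atTop
  have h3 : HasSum (fun n => 1 / 4 * e2Summand n ⟨τ, hτ⟩) (1 / 4 * G2 ⟨τ, hτ⟩)
      (symmetricIcc ℤ) := (summable_e2Summand_symmetricIcc ⟨τ, hτ⟩).hasSum.mul_left _
  have h4 : HasSum (rowDefect τ) 0 (symmetricIcc ℤ) := by
    rw [hasSum_symmetricIcc_iff]
    refine tendsto_const_nhds.congr fun N => Eq.symm ?_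
    have : ∑ n ∈ Finset.Icc (-(N : ℤ)) N, rowDefect τ n =
        ∑ n ∈ Finset.Icc (-(N : ℤ)) N, rowDefect τ (-n) :=
      Finset.sum_nbij' (fun n => -n) (fun n => -n) (by simp; omega) (by simp; omega) (by simp)
        (by simp) (by simp)
    simp only [rowDefect_neg hτ, Finset.sum_neg_distrib] at this
    exact self_eq_neg.1 this
  have h5 := h3.add h4
  have h6 := h2.unique h5
  rw [h6, E2]
  simp only [Pi.smul_apply, smul_eq_mul, riemannZeta_two]
  have : (Real.pi : ℂ) ≠ 0 := by exact_mod_cast Real.pi_ne_zero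
  field_simp
  ring

end WeierstrassEta

/-! ### Cusp forms for the full modular group -/

section LevelOne

open Filter Topology
open scoped MatrixGroups ModularForm

/-- The filter of neighbourhoods of `i∞` in the complex plane. -/
def imInfty : Filter ℂ := comap Complex.im atTop

theorem tendsto_coe_imInfty :
    Tendsto (fun z : UpperHalfPlane => (z : ℂ)) UpperHalfPlane.atImInfty imInfty :=
  tendsto_comap_iff.2 tendsto_comap

theorem eventually_imInfty (A : ℝ) : ∀ᶠ τ in imInfty, A < Complex.im τ :=
  tendsto_comap.eventually (eventually_gt_atTop A)

instance imInfty_neBot : NeBot imInfty := by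
  refine comap_neBot fun s hs => ?_
  obtain ⟨a, ha⟩ := mem_atTop_sets.1 hs
  exact ⟨⟨0, a⟩, ha a le_rfl⟩

theorem neg_one_div_im_pos {τ : ℂ} (hτ : 0 < τ.im) : 0 < (-1 / τ).im := by
  have h0 : τ ≠ 0 := fun h => by simp [h] at hτ
  rw [neg_div, neg_im, one_div, inv_im, neg_div, neg_neg]
  exact div_pos hτ (normSq_pos.2 h0)

/-- Holomorphic functions on the upper half-plane which transform with weight `k` under the
modular group and vanish at `i∞`. -/
structure IsLevelOneCusp (k : ℕ) (f : ℂ → ℂ) : Prop where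
  diff : ∀ τ, 0 < τ.im → DifferentiableAt ℂ f τ
  add_one : ∀ τ, 0 < τ.im → f (τ + 1) = f τ
  neg_one_div : ∀ τ, 0 < τ.im → f (-1 / τ) = τ ^ k * f τ
  zero : Tendsto f imInfty (𝓝 0)

variable {k : ℕ} {f : ℂ → ℂ}

/-- `S` and `T` generate the modular group, so invariance under them is invariance under all of it;
vanishing at `i∞` then gives vanishing at every cusp. -/
theorem IsLevelOneCusp.exists_cuspForm (h : IsLevelOneCusp k f) :
    ∃ F : CuspForm 𝒮ℒ k, ∀ z : UpperHalfPlane, F z = f z := by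
  set g : UpperHalfPlane → ℂ := fun z => f z with hg
  have hS : g ∣[(k : ℤ)] ModularGroup.S = g := by
    ext z
    rw [SlashInvariantForm.slash_S_apply]
    have := h.neg_one_div z z.im_pos
    have hz := z.ne_zero
    have e : (-1 / z : ℂ) = (-(z : ℂ))⁻¹ := by rw [inv_neg, neg_div, one_div]
    rw [e] at this
    simp only [hg]
    rw [UpperHalfPlane.coe_mk, this, zpow_neg, zpow_natCast]
    field_simp
  have hT : g ∣[(k : ℤ)] ModularGroup.T = g := by
    ext z
    rw [ModularForm.SL_slash_apply, UpperHalfPlane.modular_T_smul]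
    have := h.add_one z z.im_pos
    have hden : UpperHalfPlane.denom ModularGroup.T z = 1 := by
      rw [ModularGroup.denom_apply]
      simp [ModularGroup.coe_T]
    rw [hden]
    simpa [hg, add_comm] using this
  have hall := SlashInvariantForm.slash_action_generators_SL2Z hS hT
  refine ⟨{ toFun := g
            slash_action_eq' := ?_
            holo' := ?_
            zero_at_cusps' := ?_ }, fun z => rfl⟩
  · rintro _ ⟨A, rfl⟩
    exact hall A
  · rw [UpperHalfPlane.mdifferentiable_iff]
    refine DifferentiableOn.congr (f := f)
      (fun z hz => (h.diff z hz).differentiableWithinAt) fun z hz => ?_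
    simp [hg, UpperHalfPlane.ofComplex_apply_of_im_pos hz]
  · intro c hc
    rw [Subgroup.IsArithmetic.isCusp_iff_isCusp_SL2Z] at hc
    rw [OnePoint.isZeroAt_iff_forall_SL2Z hc]
    intro γ _
    rw [hall]
    exact h.zero.comp tendsto_coe_imInfty

theorem IsLevelOneCusp.eq_zero (h : IsLevelOneCusp k f) (hk : k < 12) {τ : ℂ} (hτ : 0 < τ.im) :
    f τ = 0 := by
  obtain ⟨F, hF⟩ := h.exists_cuspForm
  have h0 : F = 0 := rank_zero_iff_forall_zero.1
    (CuspForm.rank_eq_zero_of_weight_lt_twelve (by exact_mod_cast hk)) F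
  rw [← show F ⟨τ, hτ⟩ = f τ from hF ⟨τ, hτ⟩, h0]
  rfl

theorem IsLevelOneCusp.exists_eq_eta_pow (h : IsLevelOneCusp 12 f) :
    ∃ c : ℂ, ∀ τ : ℂ, 0 < τ.im → f τ = c * ModularForm.eta τ ^ 24 := by
  obtain ⟨F, hF⟩ := h.exists_cuspForm
  obtain ⟨c, hc⟩ := CuspForm.exists_smul_discriminant_of_weight_eq_twelve F
  refine ⟨c, fun τ hτ => ?_⟩
  rw [← show F ⟨τ, hτ⟩ = f τ from hF ⟨τ, hτ⟩, ← hc]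
  rfl

/-- Cauchy's estimate for `f - c` on the disc of radius `1` around `τ`. -/
theorem tendsto_deriv_imInfty {c : ℂ} (hd : ∀ τ, 0 < τ.im → DifferentiableAt ℂ f τ)
    (hf : Tendsto f imInfty (𝓝 c)) : Tendsto (deriv f) imInfty (𝓝 0) := by
  rw [Metric.tendsto_nhds] at hf ⊢
  intro ε hε
  obtain ⟨A, hA⟩ := (((atTop_basis).comap Complex.im).eventually_iff.1 (hf (ε / 2) (half_pos hε)))
  -- The first bound keeps the unit disc above height `A`, the second keeps it in the upper
  -- half-plane.
  filter_upwards [eventually_imInfty (A + 1), eventually_imInfty 1] with τ h1 h2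
  have him : ∀ w ∈ Metric.closedBall τ 1, τ.im - 1 ≤ w.im := fun w hw => by
    have := (abs_le.1 ((abs_im_le_norm (w - τ)).trans (by simpa [dist_eq] using hw))).1
    rw [sub_im] at this
    linarith
  have hdc : DiffContOnCl ℂ (fun t => f t - c) (Metric.ball τ 1) := by
    refine DifferentiableOn.diffContOnCl fun w hw => ?_
    have hw' : w ∈ Metric.closedBall τ 1 := Metric.closure_ball_subset_closedBall hw
    refine ((hd w ?_).sub_const c).differentiableWithinAt
    linarith [him w hw']
  have := norm_deriv_le_of_forall_mem_sphere_norm_le (C := ε / 2) one_pos hdc fun w hw => by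
    have := him w (Metric.sphere_subset_closedBall hw)
    have h := hA.2 (show w ∈ _ from (by simp; linarith))
    rw [dist_eq] at h
    exact h.le
  rw [deriv_sub_const] at this
  rw [dist_zero_right]
  linarith

end LevelOne

/-! ### Theta series over the half-integers -/

section HalfTheta

open Filter Topology

/-- Coefficient sequences for which all theta series converge. -/
def ThetaSummable (a : ℤ → ℂ) : Prop :=
  ∀ S T : ℝ, 0 < T →
    Summable fun n : ℤ => ‖a n‖ * Real.exp (-Real.pi * (T * n ^ 2 - 2 * S * |n|))

/-- Theta series over the half-integers. -/
def halfTheta (a : ℤ → ℂ) (τ : ℂ) : ℂ :=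
  ∑' n : ℤ, a n * exp (((n : ℂ) + 1 / 2) ^ 2 * Real.pi * I * τ)

variable {a : ℤ → ℂ} {τ : ℂ}

theorem norm_odd_pow_le (j : ℕ) (n : ℤ) :
    ‖(2 * (n : ℂ) + 1) ^ j‖ ≤ 3 ^ j * (|(n : ℝ)| ^ j + |(n : ℝ)| ^ 0) := by
  have h1 : ‖(2 * (n : ℂ) + 1)‖ = |2 * (n : ℝ) + 1| := by
    rw [← Real.norm_eq_abs, ← Complex.norm_real]; push_cast; rfl
  rw [norm_pow, h1, pow_zero]
  have h0 := abs_nonneg (n : ℝ)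
  rcases eq_or_ne n 0 with rfl | hn
  · simp only [Int.cast_zero, mul_zero, zero_add, abs_one, one_pow, abs_zero]
    have : (1 : ℝ) ≤ 3 ^ j := one_le_pow₀ (by norm_num)
    nlinarith [pow_nonneg le_rfl j (a := (0 : ℝ))]
  · have h2 : (1 : ℝ) ≤ |(n : ℝ)| := by exact_mod_cast Int.one_le_abs hn
    have h3 : |2 * (n : ℝ) + 1| ≤ 3 * |(n : ℝ)| := by
      refine (abs_add_le _ _).trans ?_
      rw [abs_mul, abs_one, abs_two]
      linarith
    calc |2 * (n : ℝ) + 1| ^ j ≤ (3 * |(n : ℝ)|) ^ j := pow_le_pow_left₀ (abs_nonneg _) h3 j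
      _ = 3 ^ j * |(n : ℝ)| ^ j := mul_pow _ _ _
      _ ≤ _ := by
        refine mul_le_mul_of_nonneg_left ?_ (by positivity)
        linarith

theorem thetaSummable_of_le (j : ℕ) (C : ℝ) (h : ∀ n, ‖a n‖ ≤ C * ‖(2 * (n : ℂ) + 1) ^ j‖) :
    ThetaSummable a := by
  intro S T hT
  have hs := ((summable_pow_mul_jacobiTheta₂_term_bound S hT j).add
    (summable_pow_mul_jacobiTheta₂_term_bound S hT 0)).mul_left (|C| * 3 ^ j)
  refine Summable.of_nonneg_of_le (fun n => by positivity) (fun n => ?_) hs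
  have h1 : ‖a n‖ ≤ |C| * 3 ^ j * (|(n : ℝ)| ^ j + |(n : ℝ)| ^ 0) := by
    refine (h n).trans ?_
    rw [mul_assoc]
    exact mul_le_mul (le_abs_self C) (norm_odd_pow_le j n) (norm_nonneg _) (abs_nonneg _)
  calc _ ≤ |C| * 3 ^ j * (|(n : ℝ)| ^ j + |(n : ℝ)| ^ 0) *
        Real.exp (-Real.pi * (T * n ^ 2 - 2 * S * |n|)) :=
      mul_le_mul_of_nonneg_right h1 (Real.exp_pos _).le
    _ = _ := by push_cast; ring

theorem norm_exp_half (n : ℤ) (τ : ℂ) : ‖exp (((n : ℂ) + 1 / 2) ^ 2 * Real.pi * I * τ)‖ =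
    Real.exp (-Real.pi * ((n : ℝ) + 1 / 2) ^ 2 * τ.im) := by
  rw [Complex.norm_exp]
  have : ((n : ℂ) + 1 / 2) ^ 2 * Real.pi * I * τ =
      ((((n : ℝ) + 1 / 2) ^ 2 * Real.pi : ℝ) : ℂ) * (τ * I) := by push_cast; ring
  rw [this, re_ofReal_mul, mul_I_re]
  ring_nf

theorem int_mul_succ_nonneg (n : ℤ) : (0 : ℝ) ≤ (n : ℝ) ^ 2 + n := by
  have : 0 ≤ n ^ 2 + n := by
    rcases le_or_gt 0 n with h | h <;> nlinarith
  exact_mod_cast this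

/-- `(n + 1 / 2) ^ 2 ≥ n ^ 2 + n ≥ n ^ 2 - |n|`, and `n ^ 2 + n ≥ 0` for integers allows `τ.im` to
be lowered to `T`. The shape is that of `ThetaSummable` with `S = T / 2`. -/
theorem norm_exp_half_le {T : ℝ} (hT : 0 < T) (n : ℤ) (h : T ≤ τ.im) :
    ‖exp (((n : ℂ) + 1 / 2) ^ 2 * Real.pi * I * τ)‖ ≤
      Real.exp (-Real.pi * (T * n ^ 2 - 2 * (T / 2) * |n|)) := by
  rw [norm_exp_half, Real.exp_le_exp]
  have h1 := int_mul_succ_nonneg n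
  have h2 : T * ((n : ℝ) ^ 2 - |(n : ℝ)|) ≤ ((n : ℝ) + 1 / 2) ^ 2 * τ.im :=
    calc T * ((n : ℝ) ^ 2 - |(n : ℝ)|) ≤ T * ((n : ℝ) ^ 2 + n) :=
          mul_le_mul_of_nonneg_left (by linarith [neg_abs_le (n : ℝ)]) hT.le
      _ ≤ τ.im * ((n : ℝ) ^ 2 + n) := mul_le_mul_of_nonneg_right h h1
      _ ≤ _ := by nlinarith
  push_cast
  nlinarith [Real.pi_pos, mul_le_mul_of_nonneg_left h2 Real.pi_pos.le]

/-- Termwise differentiation, with a uniform summable majorant on the half-plane above `τ.im / 2`.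
-/
theorem hasDerivAt_halfTheta (ha : ThetaSummable a) (hτ : 0 < τ.im) :
    HasDerivAt (halfTheta a)
      (halfTheta (fun n => a n * (((n : ℂ) + 1 / 2) ^ 2 * Real.pi * I)) τ) τ := by
  have hT : 0 < τ.im / 2 := half_pos hτ
  set U : Set ℂ := {t | τ.im / 2 < t.im}
  have hU : IsOpen U := isOpen_lt continuous_const continuous_im
  have hmem : τ ∈ U := by simp only [U, Set.mem_ofPred_eq]; linarith
  have hd : ∀ (n : ℤ) (t : ℂ), HasDerivAt
      (fun t => a n * exp (((n : ℂ) + 1 / 2) ^ 2 * Real.pi * I * t))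
      (a n * (((n : ℂ) + 1 / 2) ^ 2 * Real.pi * I) *
        exp (((n : ℂ) + 1 / 2) ^ 2 * Real.pi * I * t)) t := fun n t => by
    have := (((hasDerivAt_id t).const_mul (((n : ℂ) + 1 / 2) ^ 2 * Real.pi * I)).cexp).const_mul (a n)
    refine this.congr_deriv ?_
    simp only [id]
    ring
  have hle : ∀ (n : ℤ) (t : ℂ), t ∈ U → ‖a n * exp (((n : ℂ) + 1 / 2) ^ 2 * Real.pi * I * t)‖ ≤
      ‖a n‖ * Real.exp (-Real.pi * (τ.im / 2 * n ^ 2 - 2 * (τ.im / 2 / 2) * |n|)) :=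
    fun n t ht => by
      rw [norm_mul]
      exact mul_le_mul_of_nonneg_left (norm_exp_half_le hT n (le_of_lt ht)) (norm_nonneg _)
  have hs := ha (τ.im / 2 / 2) (τ.im / 2) hT
  have hdiff : DifferentiableOn ℂ (halfTheta a) U :=
    differentiableOn_tsum_of_summable_norm hs
      (fun n t _ => (hd n t).differentiableAt.differentiableWithinAt) hU hle
  have hsum := hasSum_deriv_of_summable_norm hs
      (fun n t _ => (hd n t).differentiableAt.differentiableWithinAt) hU hle hmem
  have h1 := (hdiff.differentiableAt (hU.mem_nhds hmem)).hasDerivAt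
  refine h1.congr_deriv ?_
  refine hsum.tsum_eq.symm.trans ?_
  exact tsum_congr fun n => (hd n τ).deriv

theorem norm_exp_mul_pi_I (c : ℝ) (τ : ℂ) :
    ‖exp (c * Real.pi * I * τ)‖ = Real.exp (-(c * Real.pi * τ.im)) := by
  have : (c * Real.pi * I * τ : ℂ) = ((c * Real.pi : ℝ) : ℂ) * (τ * I) := by push_cast; ring
  rw [Complex.norm_exp, this, re_ofReal_mul, mul_I_re]
  ring_nf

theorem tendsto_exp_imInfty {c : ℝ} (hc : 0 < c) :
    Tendsto (fun τ : ℂ => exp (c * Real.pi * I * τ)) imInfty (𝓝 0) := by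
  rw [tendsto_zero_iff_norm_tendsto_zero]
  simp only [norm_exp_mul_pi_I]
  refine Real.tendsto_exp_neg_atTop_nhds_zero.comp ?_
  exact tendsto_comap.const_mul_atTop (mul_pos hc Real.pi_pos)

/-- Removing `exp (π i τ / 4)` leaves the exponents `n ^ 2 + n`, which vanish only at `n = 0` and `n
= -1`; the other terms tend to zero under a common majorant. -/
theorem tendsto_halfTheta (ha : ThetaSummable a) :
    Tendsto (fun τ => halfTheta a τ * exp (-(Real.pi * I * τ / 4))) imInfty
      (𝓝 (a 0 + a (-1))) := by
  have hlim : ∑' n : ℤ, (if n = 0 ∨ n = -1 then a n else 0) = a 0 + a (-1) := by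
    rw [tsum_eq_sum (s := {0, -1}) (by intro n hn; simp at hn; simp [hn])]
    simp
  rw [← hlim]
  have e : (fun τ => halfTheta a τ * exp (-(Real.pi * I * τ / 4))) = fun τ =>
      ∑' n : ℤ, a n * exp (((n ^ 2 + n : ℤ) : ℝ) * Real.pi * I * τ) := by
    ext τ
    rw [halfTheta, ← tsum_mul_right]
    refine tsum_congr fun n => ?_
    rw [mul_assoc, ← exp_add]
    congr 2
    push_cast
    ring
  rw [e]
  refine tendsto_tsum_of_dominated_convergence (ha (1 / 2) 1 one_pos) (fun n => ?_) ?_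
  · split_ifs with h
    · have : n ^ 2 + n = 0 := by rcases h with rfl | rfl <;> norm_num
      simp [this]
    · have : 0 < n ^ 2 + n := by
        have h1 : n ≠ 0 := fun h' => h (Or.inl h')
        have h2 : n ≠ -1 := fun h' => h (Or.inr h')
        rcases lt_or_gt_of_ne h1 with h3 | h3
        · have : n ≤ -2 := by omega
          nlinarith
        · nlinarith
      have h3 : (0 : ℝ) < ((n ^ 2 + n : ℤ) : ℝ) := Int.cast_pos.2 this
      have h4 := (tendsto_exp_imInfty h3).const_mul (a n)
      rwa [mul_zero] at h4
  · filter_upwards [eventually_imInfty 1] with τ hτ n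
    rw [norm_mul]
    refine mul_le_mul_of_nonneg_left ?_ (norm_nonneg _)
    rw [norm_exp_mul_pi_I, Real.exp_le_exp]
    have h1 := int_mul_succ_nonneg n
    have h2 : (n : ℝ) ^ 2 - |(n : ℝ)| ≤ ((n : ℝ) ^ 2 + n) * τ.im :=
      calc (n : ℝ) ^ 2 - |(n : ℝ)| ≤ (n : ℝ) ^ 2 + n := by linarith [neg_abs_le (n : ℝ)]
        _ ≤ _ := le_mul_of_one_le_right h1 hτ.le
    have h3 := mul_le_mul_of_nonneg_left h2 Real.pi_pos.le
    push_cast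
    linarith

/-- `(n + 1 / 2) ^ 2 = n (n + 1) + 1 / 4` and `n (n + 1)` is even. -/
theorem halfTheta_add_one (a : ℤ → ℂ) (τ : ℂ) :
    halfTheta a (τ + 1) = exp (Real.pi * I / 4) * halfTheta a τ := by
  rw [halfTheta, halfTheta, ← tsum_mul_left]
  refine tsum_congr fun n => ?_
  obtain ⟨m, hm⟩ := Int.even_mul_succ_self n
  have hm' : (n : ℂ) * (n + 1) = m + m := by exact_mod_cast hm
  have : ((n : ℂ) + 1 / 2) ^ 2 * Real.pi * I * (τ + 1) =
      ((n : ℂ) + 1 / 2) ^ 2 * Real.pi * I * τ + Real.pi * I / 4 + m * (2 * Real.pi * I) := by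
    linear_combination (Real.pi * I) * hm'
  rw [this, exp_add, exp_int_mul_two_pi_mul_I, exp_add]
  ring

end HalfTheta

/-! ### Transformation laws and limits of the theta constants -/

section ThetaConstants

open Filter Topology

variable {τ : ℂ}

theorem exp_int_mul_pi_I (n : ℤ) : exp (n * (Real.pi * I)) = (-1) ^ n := by
  rw [exp_int_mul, exp_pi_mul_I]

theorem vartheta2_eq_halfTheta : vartheta2 = halfTheta fun _ => 1 := by
  ext τ
  simp [vartheta2, halfTheta]

theorem vartheta3_eq (τ : ℂ) : vartheta3 τ = jacobiTheta₂ 0 τ :=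
  tsum_congr fun n => by rw [jacobiTheta₂_term]; ring_nf

theorem vartheta4_eq (τ : ℂ) : vartheta4 τ = jacobiTheta₂ (1 / 2) τ :=
  tsum_congr fun n => by
    rw [jacobiTheta₂_term, ← exp_int_mul_pi_I, ← exp_add]
    ring_nf

theorem vartheta2_eq (τ : ℂ) :
    vartheta2 τ = exp (Real.pi * I * τ / 4) * jacobiTheta₂ (τ / 2) τ := by
  rw [vartheta2, jacobiTheta₂, ← tsum_mul_left]
  refine tsum_congr fun n => ?_
  rw [jacobiTheta₂_term, ← exp_add]
  ring_nf

theorem vartheta3_add_one (τ : ℂ) : vartheta3 (τ + 1) = vartheta4 τ := by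
  refine tsum_congr fun n => ?_
  obtain ⟨m, hm⟩ := Int.even_mul_succ_self n
  have hm' : (n : ℂ) * (n + 1) = m + m := by exact_mod_cast hm
  have : (n : ℂ) ^ 2 * Real.pi * I * (τ + 1) =
      n * (Real.pi * I) + n ^ 2 * Real.pi * I * τ + ((m - n : ℤ) : ℂ) * (2 * Real.pi * I) := by
    push_cast
    linear_combination (Real.pi * I) * hm'
  rw [this, exp_add, exp_int_mul_two_pi_mul_I, exp_add, exp_int_mul_pi_I, mul_one]

theorem vartheta4_add_one (τ : ℂ) : vartheta4 (τ + 1) = vartheta3 τ := by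
  refine tsum_congr fun n => ?_
  obtain ⟨m, hm⟩ := Int.even_mul_succ_self n
  have hm' : (n : ℂ) * (n + 1) = m + m := by exact_mod_cast hm
  have : n * (Real.pi * I) + (n : ℂ) ^ 2 * Real.pi * I * (τ + 1) =
      n ^ 2 * Real.pi * I * τ + m * (2 * Real.pi * I) := by
    linear_combination (Real.pi * I) * hm'
  rw [← exp_int_mul_pi_I, ← exp_add, this, exp_add, exp_int_mul_two_pi_mul_I, mul_one]

theorem vartheta2_add_one (τ : ℂ) :
    vartheta2 (τ + 1) = exp (Real.pi * I / 4) * vartheta2 τ := by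
  rw [vartheta2_eq_halfTheta, halfTheta_add_one]

theorem sqrt_neg_I_mul_ne_zero (hτ : 0 < τ.im) : (-I * τ) ^ (1 / 2 : ℂ) ≠ 0 := by
  have h0 : τ ≠ 0 := fun h => by simp [h] at hτ
  rw [Ne, cpow_eq_zero_iff]
  simp [h0]

theorem sqrt_neg_I_mul_sq (τ : ℂ) : ((-I * τ) ^ (1 / 2 : ℂ)) ^ 2 = -I * τ := by
  rw [one_div]
  exact_mod_cast cpow_nat_inv_pow (-I * τ) two_ne_zero

theorem vartheta3_neg_one_div (hτ : 0 < τ.im) :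
    vartheta3 (-1 / τ) = (-I * τ) ^ (1 / 2 : ℂ) * vartheta3 τ := by
  have := jacobiTheta₂_functional_equation 0 τ
  have hs := sqrt_neg_I_mul_ne_zero hτ
  rw [vartheta3_eq, vartheta3_eq, this, zero_div, zero_pow two_ne_zero, mul_zero, zero_div,
    exp_zero, mul_one, one_div ((-I * τ) ^ (1 / 2 : ℂ)), mul_inv_cancel_left₀ hs]

theorem vartheta4_neg_one_div (hτ : 0 < τ.im) :
    vartheta4 (-1 / τ) = (-I * τ) ^ (1 / 2 : ℂ) * vartheta2 τ := by
  have h0 : τ ≠ 0 := fun h => by simp [h] at hτ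
  have h := jacobiTheta₂_functional_equation (τ / 2) τ
  have hs := sqrt_neg_I_mul_ne_zero hτ
  have e1 : τ / 2 / τ = 1 / 2 := by field_simp
  have e2 : -Real.pi * I * (τ / 2) ^ 2 / τ = -(Real.pi * I * τ / 4) := by field_simp; ring
  rw [e1, e2, exp_neg] at h
  rw [vartheta4_eq, vartheta2_eq, h]
  have := exp_ne_zero (Real.pi * I * τ / 4)
  field_simp

theorem vartheta2_neg_one_div (hτ : 0 < τ.im) :
    vartheta2 (-1 / τ) = (-I * τ) ^ (1 / 2 : ℂ) * vartheta4 τ := by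
  have h0 : τ ≠ 0 := fun h => by simp [h] at hτ
  have h := jacobiTheta₂_functional_equation (1 / 2) τ
  have hs := sqrt_neg_I_mul_ne_zero hτ
  have e1 : (-1 / τ) / 2 = -(1 / 2 / τ) := by ring
  have e2 : -Real.pi * I * (1 / 2) ^ 2 / τ = Real.pi * I * (-1 / τ) / 4 := by field_simp; ring
  rw [e2] at h
  rw [vartheta4_eq, vartheta2_eq, h, e1, jacobiTheta₂_neg_left]
  field_simp

/-- The fourth power of `ϑ₄`. -/
def thetaX (τ : ℂ) : ℂ := vartheta4 τ ^ 4

/-- The fourth power of `ϑ₂`. -/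
def thetaY (τ : ℂ) : ℂ := vartheta2 τ ^ 4

/-- Minus the fourth power of `ϑ₃`, so that `thetaX + thetaY + thetaW = 0`. -/
def thetaW (τ : ℂ) : ℂ := -vartheta3 τ ^ 4

theorem sqrt_neg_I_mul_pow_four (τ : ℂ) : ((-I * τ) ^ (1 / 2 : ℂ)) ^ 4 = -τ ^ 2 := by
  rw [show 4 = 2 * 2 by norm_num, pow_mul, sqrt_neg_I_mul_sq, mul_pow, neg_sq, I_sq]
  ring

theorem thetaX_neg_one_div (hτ : 0 < τ.im) : thetaX (-1 / τ) = -τ ^ 2 * thetaY τ := by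
  rw [thetaX, vartheta4_neg_one_div hτ, mul_pow, sqrt_neg_I_mul_pow_four, thetaY]

theorem thetaY_neg_one_div (hτ : 0 < τ.im) : thetaY (-1 / τ) = -τ ^ 2 * thetaX τ := by
  rw [thetaY, vartheta2_neg_one_div hτ, mul_pow, sqrt_neg_I_mul_pow_four, thetaX]

theorem thetaW_neg_one_div (hτ : 0 < τ.im) : thetaW (-1 / τ) = -τ ^ 2 * thetaW τ := by
  rw [thetaW, vartheta3_neg_one_div hτ, mul_pow, sqrt_neg_I_mul_pow_four, thetaW]
  ring

theorem thetaX_add_one (τ : ℂ) : thetaX (τ + 1) = -thetaW τ := by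
  rw [thetaX, vartheta4_add_one, thetaW, neg_neg]

theorem thetaW_add_one (τ : ℂ) : thetaW (τ + 1) = -thetaX τ := by
  rw [thetaW, vartheta3_add_one, thetaX]

theorem exp_pi_I_div_four_pow_four : exp (Real.pi * I / 4) ^ 4 = -1 := by
  rw [← exp_nat_mul, ← exp_pi_mul_I]
  congr 1
  push_cast
  ring

theorem thetaY_add_one (τ : ℂ) : thetaY (τ + 1) = -thetaY τ := by
  rw [thetaY, vartheta2_add_one, mul_pow, exp_pi_I_div_four_pow_four, thetaY]
  ring

theorem thetaSummable_one : ThetaSummable fun _ => 1 :=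
  thetaSummable_of_le 0 1 fun n => by simp

theorem differentiableAt_vartheta2 (hτ : 0 < τ.im) : DifferentiableAt ℂ vartheta2 τ := by
  rw [vartheta2_eq_halfTheta]
  exact (hasDerivAt_halfTheta thetaSummable_one hτ).differentiableAt

theorem differentiableAt_vartheta3 (hτ : 0 < τ.im) : DifferentiableAt ℂ vartheta3 τ := by
  rw [funext vartheta3_eq]
  exact differentiableAt_jacobiTheta₂_snd 0 hτ

theorem differentiableAt_vartheta4 (hτ : 0 < τ.im) : DifferentiableAt ℂ vartheta4 τ := by
  rw [funext vartheta4_eq]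
  exact differentiableAt_jacobiTheta₂_snd (1 / 2) hτ

theorem differentiableAt_thetaX (hτ : 0 < τ.im) : DifferentiableAt ℂ thetaX τ :=
  (differentiableAt_vartheta4 hτ).pow 4

theorem differentiableAt_thetaY (hτ : 0 < τ.im) : DifferentiableAt ℂ thetaY τ :=
  (differentiableAt_vartheta2 hτ).pow 4

theorem differentiableAt_thetaW (hτ : 0 < τ.im) : DifferentiableAt ℂ thetaW τ :=
  ((differentiableAt_vartheta3 hτ).pow 4).neg

theorem tendsto_vartheta3 : Tendsto vartheta3 imInfty (𝓝 1) := by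
  rw [← tendsto_sub_nhds_zero_iff]
  have h := isBigO_at_im_infty_jacobiTheta_sub_one
  have e : vartheta3 = jacobiTheta := by
    ext τ
    rw [vartheta3_eq, jacobiTheta_eq_jacobiTheta₂]
  rw [e]
  refine h.trans_tendsto ?_
  have : Tendsto (fun τ : ℂ => Real.pi * τ.im) imInfty atTop :=
    tendsto_comap.const_mul_atTop Real.pi_pos
  refine (Real.tendsto_exp_neg_atTop_nhds_zero.comp this).congr fun τ => ?_
  simp

theorem tendsto_add_one_imInfty : Tendsto (fun τ : ℂ => τ + 1) imInfty imInfty :=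
  tendsto_comap_iff.2 (tendsto_comap.congr fun τ => by simp)

theorem tendsto_vartheta4 : Tendsto vartheta4 imInfty (𝓝 1) :=
  (tendsto_vartheta3.comp tendsto_add_one_imInfty).congr vartheta3_add_one

theorem tendsto_vartheta2_mul_exp :
    Tendsto (fun τ => vartheta2 τ * exp (-(Real.pi * I * τ / 4))) imInfty (𝓝 2) := by
  have := tendsto_halfTheta thetaSummable_one
  rw [← vartheta2_eq_halfTheta] at this
  convert this using 2
  norm_num

theorem tendsto_thetaX : Tendsto thetaX imInfty (𝓝 1) := by
  simpa only [one_pow] using! tendsto_vartheta4.pow 4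

theorem tendsto_thetaW : Tendsto thetaW imInfty (𝓝 (-1)) := by
  simpa only [one_pow] using! (tendsto_vartheta3.pow 4).neg

/-- The fourth power of `ϑ₂` without its leading exponential factor. -/
def thetaYReg (τ : ℂ) : ℂ := thetaY τ * exp (-(Real.pi * I * τ))

theorem tendsto_thetaYReg : Tendsto thetaYReg imInfty (𝓝 16) := by
  have := tendsto_vartheta2_mul_exp.pow 4
  norm_num at this
  refine this.congr fun τ => ?_
  rw [mul_pow, ← exp_nat_mul, thetaYReg, thetaY]
  congr 2
  push_cast
  ring

theorem thetaY_eq (τ : ℂ) : thetaY τ = thetaYReg τ * exp (Real.pi * I * τ) := by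
  rw [thetaYReg, mul_assoc, ← exp_add]
  simp

theorem tendsto_thetaY : Tendsto thetaY imInfty (𝓝 0) := by
  have h := tendsto_thetaYReg.mul (tendsto_exp_imInfty one_pos)
  simp only [ofReal_one, one_mul, mul_zero] at h
  exact h.congr fun τ => (thetaY_eq τ).symm

theorem differentiableAt_thetaYReg (hτ : 0 < τ.im) : DifferentiableAt ℂ thetaYReg τ :=
  (differentiableAt_thetaY hτ).mul (by fun_prop)

/-- `θ₁'(0|τ)`. -/
def thetaPrime (τ : ℂ) : ℂ := Real.pi * halfTheta (fun n => (-1) ^ n * (2 * n + 1)) τ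

theorem thetaSummable_odd_pow (j : ℕ) :
    ThetaSummable fun n => (-1) ^ n * (2 * (n : ℂ) + 1) ^ j :=
  thetaSummable_of_le j 1 fun n => by simp

theorem thetaSummable_thetaPrime : ThetaSummable fun n => (-1) ^ n * (2 * (n : ℂ) + 1) := by
  simpa using thetaSummable_odd_pow 1

theorem differentiableAt_thetaPrime (hτ : 0 < τ.im) : DifferentiableAt ℂ thetaPrime τ :=
  (hasDerivAt_halfTheta thetaSummable_thetaPrime hτ).differentiableAt.const_mul _

theorem tendsto_thetaPrime_mul_exp :
    Tendsto (fun τ => thetaPrime τ * exp (-(Real.pi * I * τ / 4))) imInfty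
      (𝓝 (2 * Real.pi)) := by
  have := (tendsto_halfTheta thetaSummable_thetaPrime).const_mul (Real.pi : ℂ)
  convert this using 2
  · rw [thetaPrime, mul_assoc]
  · norm_num
    ring

theorem thetaPrime_add_one (τ : ℂ) :
    thetaPrime (τ + 1) = exp (Real.pi * I / 4) * thetaPrime τ := by
  rw [thetaPrime, halfTheta_add_one, thetaPrime]
  ring

theorem exp_half_sq (n : ℤ) (τ : ℂ) : exp (((n : ℂ) + 1 / 2) ^ 2 * Real.pi * I * τ) =
    exp (Real.pi * I * τ / 4) * (-1) ^ n * jacobiTheta₂_term n ((τ + 1) / 2) τ := by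
  have h : (-1 : ℂ) ^ n = exp (-(n * (Real.pi * I))) := by
    rw [exp_neg, exp_int_mul_pi_I, ← inv_zpow, inv_neg, inv_one]
  rw [jacobiTheta₂_term, h, ← exp_add, ← exp_add]
  ring_nf

theorem neg_one_zpow_mul_self (n : ℤ) : (-1 : ℂ) ^ n * (-1) ^ n = 1 := by
  rw [← mul_zpow]; simp

/-- The reflection `n ↦ -1 - n` preserves `(n + 1 / 2) ^ 2`. -/
theorem halfTheta_reflect {a : ℤ → ℂ} (h : ∀ n, a (-1 - n) = -a n) (τ : ℂ) :
    halfTheta a τ = 0 := by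
  rw [← self_eq_neg]
  nth_rw 1 [halfTheta]
  rw [← (Equiv.subLeft (-1 : ℤ)).tsum_eq, halfTheta, ← tsum_neg]
  refine tsum_congr fun n => ?_
  rw [Equiv.subLeft_apply, h, neg_mul]
  congr 3
  push_cast
  ring

theorem neg_one_zpow_reflect (n : ℤ) : (-1 : ℂ) ^ (-1 - n) = -(-1) ^ n := by
  rw [zpow_sub₀ (by norm_num), zpow_neg_one, inv_neg, inv_one, div_eq_iff (zpow_ne_zero _ (by simp)),
    neg_mul, neg_one_zpow_mul_self]

theorem jacobiTheta₂_zero_at_half_period (τ : ℂ) : jacobiTheta₂ ((τ + 1) / 2) τ = 0 := by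
  have h : halfTheta (fun n => (-1) ^ n) τ = 0 :=
    halfTheta_reflect neg_one_zpow_reflect τ
  have e : halfTheta (fun n => (-1) ^ n) τ =
      exp (Real.pi * I * τ / 4) * jacobiTheta₂ ((τ + 1) / 2) τ := by
    rw [halfTheta, jacobiTheta₂, ← tsum_mul_left]
    refine tsum_congr fun n => ?_
    rw [exp_half_sq]
    linear_combination (exp (Real.pi * I * τ / 4) * jacobiTheta₂_term n ((τ + 1) / 2) τ) *
      neg_one_zpow_mul_self n
  rw [e] at h
  exact (mul_eq_zero.1 h).resolve_left (exp_ne_zero _)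

/-- The derivative series carries the weight `2 π i n`; the missing `π i` multiplies `jacobiTheta₂`
at the half-period, which is zero. -/
theorem thetaPrime_eq (hτ : 0 < τ.im) : thetaPrime τ =
    -I * (exp (Real.pi * I * τ / 4) * jacobiTheta₂' ((τ + 1) / 2) τ) := by
  have h1 := hasSum_jacobiTheta₂'_term ((τ + 1) / 2) hτ
  have h2 := (hasSum_jacobiTheta₂_term ((τ + 1) / 2) hτ).mul_left (Real.pi * I)
  rw [jacobiTheta₂_zero_at_half_period, mul_zero] at h2
  have h3 := ((h1.add h2).mul_left (exp (Real.pi * I * τ / 4))).mul_left (-I)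
  rw [add_zero] at h3
  rw [← h3.tsum_eq, thetaPrime, halfTheta, ← tsum_mul_left]
  refine tsum_congr fun n => ?_
  rw [exp_half_sq, jacobiTheta₂'_term]
  linear_combination (Real.pi * (2 * n + 1) * exp (Real.pi * I * τ / 4) *
    jacobiTheta₂_term n ((τ + 1) / 2) τ) * (neg_one_zpow_mul_self n) +
    (Real.pi * (2 * n + 1) * exp (Real.pi * I * τ / 4) *
    jacobiTheta₂_term n ((τ + 1) / 2) τ) * I_sq

theorem thetaPrime_neg_one_div (hτ : 0 < τ.im) :
    thetaPrime (-1 / τ) = -I * (-I * τ) ^ (1 / 2 : ℂ) * τ * thetaPrime τ := by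
  have h0 : τ ≠ 0 := fun h => by simp [h] at hτ
  have hs := sqrt_neg_I_mul_ne_zero hτ
  have h := jacobiTheta₂'_functional_equation ((τ + 1) / 2) τ
  -- The image of the half-period `(τ + 1) / 2` is, up to sign and a period, the half-period
  -- belonging to `-1 / τ`.
  have e1 : (τ + 1) / 2 / τ = -((-1 / τ + 1) / 2) + 1 := by field_simp; ring
  have e2 : -Real.pi * I * ((τ + 1) / 2) ^ 2 / τ =
      Real.pi * I * (-1 / τ) / 4 + -(Real.pi * I * τ / 4) + -(Real.pi / 2 * I) := by
    field_simp; ring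
  have e3 : exp (-(Real.pi / 2 * I)) = -I := by
    rw [exp_neg, exp_pi_div_two_mul_I, inv_I]
  rw [e1, e2, jacobiTheta₂'_add_left, jacobiTheta₂_add_left, jacobiTheta₂'_neg_left,
    jacobiTheta₂_neg_left, jacobiTheta₂_zero_at_half_period, exp_add, exp_add, e3, exp_neg] at h
  rw [thetaPrime_eq hτ, thetaPrime_eq (neg_one_div_im_pos hτ), h]
  have := exp_ne_zero (Real.pi * I * τ / 4)
  field_simp
  ring_nf
  simp only [I_sq]
  ring

end ThetaConstants

/-! ### Identities from the absence of cusp forms of small weight -/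

section ModularIdentities

open Filter Topology

variable {τ : ℂ}

theorem isOpen_im_pos : IsOpen {τ : ℂ | 0 < τ.im} := isOpen_lt continuous_const continuous_im

theorem differentiableAt_deriv_of_im_pos {f : ℂ → ℂ}
    (hf : ∀ τ, 0 < τ.im → DifferentiableAt ℂ f τ) (hτ : 0 < τ.im) :
    DifferentiableAt ℂ (deriv f) τ := by
  have h : DifferentiableOn ℂ f {τ : ℂ | 0 < τ.im} :=
    fun t ht => (hf t ht).differentiableWithinAt
  exact (h.deriv isOpen_im_pos).differentiableAt (isOpen_im_pos.mem_nhds hτ)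

theorem differentiableAt_eta (hτ : 0 < τ.im) : DifferentiableAt ℂ ModularForm.eta τ :=
  ModularForm.differentiableAt_eta_of_mem_upperHalfPlaneSet hτ

theorem eta_ne_zero (hτ : 0 < τ.im) : ModularForm.eta τ ≠ 0 :=
  ModularForm.eta_ne_zero hτ

theorem tendsto_tprod_one_sub_pow :
    Tendsto (fun q : ℂ => ∏' n : ℕ, (1 - q ^ (n + 1))) (𝓝 0) (𝓝 1) := by
  have := tendsto_tprod_one_add_of_dominated_convergence (𝓕 := 𝓝 0) (g := 0)
    (f := fun (q : ℂ) (n : ℕ) ↦ -q ^ (n + 1)) (bound := fun n ↦ (1 / 2 : ℝ) ^ (n + 1))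
  simp only [Pi.zero_apply, norm_neg, norm_pow, add_zero, tprod_one] at this
  simp_rw [sub_eq_add_neg]
  refine this
    (by simpa only [pow_succ'] using (summable_geometric_of_abs_lt_one (by norm_num)).mul_left _)
    (fun k ↦ by simpa using ((continuous_pow (M := ℂ) (k + 1)).tendsto 0).neg) ?_
  filter_upwards [Metric.ball_mem_nhds (0 : ℂ) (by norm_num : (0 : ℝ) < 1 / 2)] with q hq k
  exact pow_le_pow_left₀ (norm_nonneg _) (mem_ball_zero_iff.mp hq).le _

/-- The Dedekind eta function without its leading exponential factor. -/
def etaReg (τ : ℂ) : ℂ := ModularForm.eta τ * exp (-(Real.pi * I * τ / 12))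

theorem tendsto_etaReg : Tendsto etaReg imInfty (𝓝 1) := by
  have h := tendsto_tprod_one_sub_pow.comp (tendsto_exp_imInfty (c := 2) two_pos)
  refine h.congr fun τ => ?_
  have e : Function.Periodic.qParam 24 τ = exp (Real.pi * I * τ / 12) := by
    rw [Function.Periodic.qParam]
    congr 1
    push_cast
    ring
  rw [etaReg, ModularForm.eta, e, mul_right_comm (exp _), ← exp_add, add_neg_cancel, exp_zero,
    one_mul]
  simp [ModularForm.eta_q_eq_pow]

theorem differentiableAt_etaReg (hτ : 0 < τ.im) : DifferentiableAt ℂ etaReg τ :=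
  (differentiableAt_eta hτ).mul (by fun_prop)

theorem eta_eq_etaReg (τ : ℂ) : ModularForm.eta τ = etaReg τ * exp (Real.pi * I * τ / 12) := by
  rw [etaReg, mul_assoc, ← exp_add]
  simp

theorem IsLevelOneCusp.eq_eta_pow {f : ℂ → ℂ} {c : ℂ} (h : IsLevelOneCusp 12 f)
    (hc : Tendsto (fun τ => f τ * exp (-(2 * Real.pi * I * τ))) imInfty (𝓝 c)) (hτ : 0 < τ.im) :
    f τ = c * ModularForm.eta τ ^ 24 := by
  obtain ⟨c', hc'⟩ := h.exists_eq_eta_pow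
  have h1 : Tendsto (fun τ => c' * etaReg τ ^ 24) imInfty (𝓝 c') := by
    simpa using (tendsto_etaReg.pow 24).const_mul c'
  have h2 : Tendsto (fun τ => c' * etaReg τ ^ 24) imInfty (𝓝 c) := by
    refine hc.congr' ?_
    filter_upwards [eventually_imInfty 0] with t ht
    rw [hc' t ht, etaReg, mul_pow, ← exp_nat_mul, mul_assoc]
    congr 3
    push_cast
    ring
  rw [hc' τ hτ, tendsto_nhds_unique h1 h2]

theorem isLevelOneCusp_twelve {f : ℂ → ℂ} {c : ℂ} (hd : ∀ τ, 0 < τ.im → DifferentiableAt ℂ f τ)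
    (hT : ∀ τ, 0 < τ.im → f (τ + 1) = f τ)
    (hS : ∀ τ, 0 < τ.im → f (-1 / τ) = τ ^ 12 * f τ)
    (hc : Tendsto (fun τ => f τ * exp (-(2 * Real.pi * I * τ))) imInfty (𝓝 c)) :
    IsLevelOneCusp 12 f := by
  refine ⟨hd, hT, hS, ?_⟩
  have h := hc.mul (tendsto_exp_imInfty (c := 2) two_pos)
  rw [mul_zero] at h
  refine h.congr fun τ => ?_
  rw [mul_assoc, ← exp_add]
  simp

/-- The eighth power has weight `8 · 3 / 2 = 12` and removes the eighth roots of unity from the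
transformation law. -/
theorem thetaPrime_pow_eight (hτ : 0 < τ.im) :
    thetaPrime τ ^ 8 = (2 * Real.pi) ^ 8 * ModularForm.eta τ ^ 24 := by
  have hc : Tendsto (fun τ => thetaPrime τ ^ 8 * exp (-(2 * Real.pi * I * τ))) imInfty
      (𝓝 ((2 * Real.pi) ^ 8)) := by
    refine (tendsto_thetaPrime_mul_exp.pow 8).congr fun t => ?_
    rw [mul_pow, ← exp_nat_mul]
    congr 2
    push_cast
    ring
  refine IsLevelOneCusp.eq_eta_pow (isLevelOneCusp_twelve (fun t ht =>
    (differentiableAt_thetaPrime ht).fun_pow 8) (fun t _ => ?_) (fun t ht => ?_) hc) hc hτ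
  · rw [thetaPrime_add_one, mul_pow, show 8 = 4 * 2 by norm_num, pow_mul (exp _),
      exp_pi_I_div_four_pow_four]
    norm_num
  · rw [thetaPrime_neg_one_div ht, mul_pow, mul_pow, mul_pow, show 8 = 4 * 2 by norm_num,
      pow_mul ((-I * t) ^ (1 / 2 : ℂ)), sqrt_neg_I_mul_pow_four, pow_mul (-I), neg_pow, I_pow_four]
    ring

/-- The quotient of the two sides is holomorphic with eighth power `1`, hence constant, and it tends
to `1` at `i∞`. -/
theorem thetaPrime_eq_eta (hτ : 0 < τ.im) :
    thetaPrime τ = 2 * Real.pi * ModularForm.eta τ ^ 3 := by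
  have hpi : (2 * Real.pi : ℂ) ≠ 0 := by simp [Real.pi_ne_zero]
  set g : ℂ → ℂ := fun t => thetaPrime t / (2 * Real.pi * ModularForm.eta t ^ 3) with hg
  have hne : ∀ t : ℂ, 0 < t.im → 2 * Real.pi * ModularForm.eta t ^ 3 ≠ 0 := fun t ht =>
    mul_ne_zero hpi (pow_ne_zero 3 (eta_ne_zero ht))
  have h8 : ∀ t : ℂ, 0 < t.im → g t ^ 8 = 1 := fun t ht => by
    simp only [hg]
    rw [div_pow, thetaPrime_pow_eight ht, mul_pow _ (ModularForm.eta t ^ 3), ← pow_mul, div_self]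
    exact mul_ne_zero (pow_ne_zero 8 hpi) (pow_ne_zero _ (eta_ne_zero ht))
  have hd : ∀ t : ℂ, 0 < t.im → DifferentiableAt ℂ g t := fun t ht =>
    (differentiableAt_thetaPrime ht).div (((differentiableAt_eta ht).pow 3).const_mul _) (hne t ht)
  have hd0 : ∀ t : ℂ, 0 < t.im → deriv g t = 0 := fun t ht => by
    have h1 : deriv (fun s => g s ^ 8) t = 0 := by
      have : (fun s => g s ^ 8) =ᶠ[𝓝 t] fun _ => 1 := by
        filter_upwards [isOpen_im_pos.mem_nhds ht] with s hs using h8 s hs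
      rw [this.deriv_eq, deriv_const]
    rw [((hd t ht).hasDerivAt.fun_pow 8).deriv] at h1
    have hg0 : g t ≠ 0 := fun h0 => by simpa [h0] using h8 t ht
    simpa [hg0] using h1
  have hconst : ∀ t : ℂ, 0 < t.im → g t = g τ := fun t ht =>
    isOpen_im_pos.is_const_of_deriv_eq_zero (convex_halfSpace_im_gt 0).isPreconnected
      (fun s hs => (hd s hs).differentiableWithinAt) hd0 ht hτ
  have hlim : Tendsto g imInfty (𝓝 1) := by
    have h := tendsto_thetaPrime_mul_exp.div ((tendsto_etaReg.pow 3).const_mul (2 * Real.pi : ℂ))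
      (by simp [Real.pi_ne_zero])
    rw [one_pow, mul_one, div_self hpi] at h
    refine h.congr fun t => ?_
    rw [Pi.div_apply, etaReg, mul_pow, ← exp_nat_mul, ← mul_assoc,
      show ((3 : ℕ) : ℂ) * -(Real.pi * I * t / 12) = -(Real.pi * I * t / 4) by push_cast; ring,
      mul_div_mul_right _ _ (exp_ne_zero _)]
  have h1 : g τ = 1 := by
    refine tendsto_nhds_unique (tendsto_const_nhds.congr' ?_) hlim
    filter_upwards [eventually_imInfty 0] with t ht using (hconst t ht).symm
  exact (div_eq_one_iff_eq (hne τ hτ)).1 h1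

/-- It serves to show that the three functions have no zeros, so that their logarithmic derivatives
are holomorphic. Squaring removes the sign under `τ ↦ τ + 1`, and `256 = 16 ^ 2` comes from the
leading coefficient of `ϑ₂ ^ 4`. -/
theorem thetaXYW_sq (hτ : 0 < τ.im) :
    (thetaX τ * thetaY τ * thetaW τ) ^ 2 = 256 * ModularForm.eta τ ^ 24 := by
  have hc : Tendsto (fun τ => (thetaX τ * thetaY τ * thetaW τ) ^ 2 *
      exp (-(2 * Real.pi * I * τ))) imInfty (𝓝 256) := by
    have := ((tendsto_thetaX.mul tendsto_thetaYReg).mul tendsto_thetaW).pow 2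
    norm_num at this
    refine this.congr fun t => ?_
    rw [thetaYReg, show -(2 * Real.pi * I * t) = (2 : ℕ) * -(Real.pi * I * t) by push_cast; ring,
      exp_nat_mul]
    ring
  refine IsLevelOneCusp.eq_eta_pow (isLevelOneCusp_twelve (fun t ht =>
    (((differentiableAt_thetaX ht).mul (differentiableAt_thetaY ht)).mul
      (differentiableAt_thetaW ht)).fun_pow 2) (fun t _ => ?_) (fun t ht => ?_) hc) hc hτ
  · simp only [Pi.mul_apply]
    rw [thetaX_add_one, thetaY_add_one, thetaW_add_one]
    ring
  · simp only [Pi.mul_apply]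
    rw [thetaX_neg_one_div ht, thetaY_neg_one_div ht, thetaW_neg_one_div ht]
    ring

theorem thetaXYW_ne_zero (hτ : 0 < τ.im) : thetaX τ * thetaY τ * thetaW τ ≠ 0 := by
  intro h
  have := thetaXYW_sq hτ
  rw [h] at this
  simp [eta_ne_zero hτ] at this

theorem thetaX_ne_zero (hτ : 0 < τ.im) : thetaX τ ≠ 0 := fun h =>
  thetaXYW_ne_zero hτ (by simp [h])

theorem thetaY_ne_zero (hτ : 0 < τ.im) : thetaY τ ≠ 0 := fun h =>
  thetaXYW_ne_zero hτ (by simp [h])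

theorem thetaW_ne_zero (hτ : 0 < τ.im) : thetaW τ ≠ 0 := fun h =>
  thetaXYW_ne_zero hτ (by simp [h])

/-- Jacobi's quartic identity: the generators permute the summands up to a common factor, and the
square is a cusp form of weight 4. -/
theorem thetaX_add_thetaY_add_thetaW (hτ : 0 < τ.im) : thetaX τ + thetaY τ + thetaW τ = 0 := by
  have h : IsLevelOneCusp 4 fun τ => (thetaX τ + thetaY τ + thetaW τ) ^ 2 := by
    refine ⟨fun t ht => (((differentiableAt_thetaX ht).add (differentiableAt_thetaY ht)).add
      (differentiableAt_thetaW ht)).fun_pow 2, fun t _ => ?_, fun t ht => ?_, ?_⟩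
    · rw [thetaX_add_one, thetaY_add_one, thetaW_add_one]
      ring
    · rw [thetaX_neg_one_div ht, thetaY_neg_one_div ht, thetaW_neg_one_div ht]
      ring
    · simpa using ((tendsto_thetaX.add tendsto_thetaY).add tendsto_thetaW).pow 2
  exact pow_eq_zero_iff two_ne_zero |>.1 (h.eq_zero (by norm_num) hτ)

/-- The quasi-modular Eisenstein series of weight two on the complex plane. -/
def eisenE (τ : ℂ) : ℂ := 12 / (Real.pi * I) * logDeriv ModularForm.eta τ

theorem pi_mul_I_ne_zero : (Real.pi * I : ℂ) ≠ 0 := by simp [Real.pi_ne_zero]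

theorem eisenE_eq (hτ : 0 < τ.im) : eisenE τ = EisensteinSeries.E2 ⟨τ, hτ⟩ := by
  have := ModularForm.logDeriv_eta_eq_E2 ⟨τ, hτ⟩
  rw [UpperHalfPlane.coe_mk] at this
  have h0 := pi_mul_I_ne_zero
  rw [eisenE, this]
  field_simp

theorem weierstrassEta_eq_eisenE (hτ : 0 < τ.im) :
    weierstrassEta τ = (Real.pi : ℂ) ^ 2 / 12 * eisenE τ := by
  rw [weierstrassEta_eq_E2 hτ, eisenE_eq hτ]

theorem deriv_eta (hτ : 0 < τ.im) :
    deriv ModularForm.eta τ = Real.pi * I / 12 * eisenE τ * ModularForm.eta τ := by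
  have h0 := pi_mul_I_ne_zero
  have h1 := eta_ne_zero hτ
  rw [eisenE, logDeriv_apply]
  field_simp

theorem differentiableAt_eisenE (hτ : 0 < τ.im) : DifferentiableAt ℂ eisenE τ :=
  ((differentiableAt_deriv_of_im_pos (fun _ => differentiableAt_eta) hτ).div
    (differentiableAt_eta hτ) (eta_ne_zero hτ)).const_mul _

theorem eisenE_add_one (hτ : 0 < τ.im) : eisenE (τ + 1) = eisenE τ := by
  have hτ' : 0 < (τ + 1).im := by simpa using hτ
  rw [eisenE_eq hτ, eisenE_eq hτ', EisensteinSeries.E2_eq_tsum_cexp,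
    EisensteinSeries.E2_eq_tsum_cexp]
  simp only [mul_add, mul_one, exp_add, exp_two_pi_mul_I]

theorem eisenE_neg_one_div (hτ : 0 < τ.im) :
    eisenE (-1 / τ) = τ ^ 2 * eisenE τ + 6 / (Real.pi * I) * τ := by
  rw [eisenE_eq hτ, eisenE_eq (neg_one_div_im_pos hτ)]
  have h := EisensteinSeries.G2_S_transform ⟨τ, hτ⟩
  have h0 : τ ≠ 0 := fun h => by simp [h] at hτ
  have hS : ModularGroup.S • (⟨τ, hτ⟩ : UpperHalfPlane) = ⟨-1 / τ, neg_one_div_im_pos hτ⟩ := by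
    rw [UpperHalfPlane.modular_S_smul]
    refine UpperHalfPlane.ext ?_
    simp [neg_div]
  rw [hS, UpperHalfPlane.coe_mk] at h
  have hpi : (Real.pi : ℂ) ≠ 0 := by simp [Real.pi_ne_zero]
  have hI := I_ne_zero
  simp only [EisensteinSeries.E2, Pi.smul_apply, smul_eq_mul, riemannZeta_two, h]
  field_simp
  ring_nf
  simp only [I_sq]
  ring

/-- `etaReg` tends to `1` and its derivative to `0`, so only the factor `exp (π i τ / 12)`
contributes to the logarithmic derivative in the limit. -/
theorem tendsto_eisenE : Tendsto eisenE imInfty (𝓝 1) := by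
  have h1 := tendsto_deriv_imInfty (fun t ht => differentiableAt_etaReg ht) tendsto_etaReg
  have h2 := (((h1.div tendsto_etaReg one_ne_zero).add_const (Real.pi * I / 12 : ℂ))).const_mul
    (12 / (Real.pi * I : ℂ))
  have h0 := pi_mul_I_ne_zero
  have e : 12 / (Real.pi * I : ℂ) * (0 / 1 + Real.pi * I / 12) = 1 := by field_simp; simp
  rw [e] at h2
  refine h2.congr' ?_
  filter_upwards [eventually_imInfty 0] with t ht
  have hne : etaReg t ≠ 0 := mul_ne_zero (eta_ne_zero ht) (exp_ne_zero _)
  have hd : HasDerivAt (fun t => etaReg t * exp (Real.pi * I * t / 12))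
      (deriv etaReg t * exp (Real.pi * I * t / 12) +
        etaReg t * (exp (Real.pi * I * t / 12) * (Real.pi * I / 12))) t := by
    refine (differentiableAt_etaReg ht).hasDerivAt.mul ?_
    exact (((hasDerivAt_id t).const_mul (Real.pi * I : ℂ)).div_const 12).cexp.congr_deriv
      (by simp)
  rw [← funext eta_eq_etaReg] at hd
  rw [eisenE, logDeriv_apply, hd.deriv, eta_eq_etaReg, Pi.div_apply]
  have := exp_ne_zero (Real.pi * I * t / 12)
  field_simp

theorem deriv_add_one {f g : ℂ → ℂ} (h : ∀ t, 0 < t.im → f (t + 1) = g t) (hτ : 0 < τ.im) :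
    deriv f (τ + 1) = deriv g τ := by
  rw [← deriv_comp_add_const]
  refine EventuallyEq.deriv_eq ?_
  filter_upwards [isOpen_im_pos.mem_nhds hτ] with t ht using h t ht

theorem deriv_neg_one_div {f g : ℂ → ℂ} (h : ∀ t, 0 < t.im → f (-1 / t) = g t)
    (hf : ∀ t, 0 < t.im → DifferentiableAt ℂ f t) (hτ : 0 < τ.im) :
    deriv f (-1 / τ) = τ ^ 2 * deriv g τ := by
  have h0 : τ ≠ 0 := fun h => by simp [h] at hτ
  have h1 : HasDerivAt (fun t : ℂ => -1 / t) (1 / τ ^ 2) τ := by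
    refine ((hasDerivAt_const τ (-1 : ℂ)).fun_div (hasDerivAt_id τ) h0).congr_deriv ?_
    simp
  have h2 := (hf _ (neg_one_div_im_pos hτ)).hasDerivAt.comp τ h1
  have h3 : deriv g τ = deriv f (-1 / τ) * (1 / τ ^ 2) := by
    rw [← h2.deriv]
    refine EventuallyEq.deriv_eq ?_
    filter_upwards [isOpen_im_pos.mem_nhds hτ] with t ht using (h t ht).symm
  rw [h3]
  field_simp

/-- The anomalous terms of `E'` and `E ^ 2` under `τ ↦ -1 / τ` cancel, so the difference of the two
sides is modular of weight 4; it vanishes at `i∞` because `E ^ 2 → 1` and `W X → -1`. -/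
theorem ramanujan_eisenE (hτ : 0 < τ.im) :
    deriv eisenE τ = Real.pi * I / 6 * (eisenE τ ^ 2 +
      (thetaX τ * thetaY τ + thetaY τ * thetaW τ + thetaW τ * thetaX τ)) := by
  have h : IsLevelOneCusp 4 fun τ => deriv eisenE τ - Real.pi * I / 6 * (eisenE τ ^ 2 +
      (thetaX τ * thetaY τ + thetaY τ * thetaW τ + thetaW τ * thetaX τ)) := by
    refine ⟨fun t ht => ?_, fun t ht => ?_, fun t ht => ?_, ?_⟩
    · have hX := differentiableAt_thetaX ht
      have hY := differentiableAt_thetaY ht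
      have hW := differentiableAt_thetaW ht
      have hE := differentiableAt_eisenE ht
      have hE' := differentiableAt_deriv_of_im_pos (fun _ => differentiableAt_eisenE) ht
      fun_prop
    · rw [deriv_add_one (fun _ => eisenE_add_one) ht, thetaX_add_one, thetaY_add_one,
        thetaW_add_one, eisenE_add_one ht]
      ring
    · have hd : deriv (fun t => t ^ 2 * eisenE t + 6 / (Real.pi * I) * t) t =
          2 * t * eisenE t + t ^ 2 * deriv eisenE t + 6 / (Real.pi * I) := by
        refine HasDerivAt.deriv ?_
        refine (((hasDerivAt_id t).fun_pow 2).mul (differentiableAt_eisenE ht).hasDerivAt |>.add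
          ((hasDerivAt_id t).const_mul _)).congr_deriv ?_
        simp
      rw [deriv_neg_one_div (fun _ => eisenE_neg_one_div) (fun _ => differentiableAt_eisenE) ht,
        thetaX_neg_one_div ht, thetaY_neg_one_div ht, thetaW_neg_one_div ht,
        eisenE_neg_one_div ht, hd]
      have h0 := pi_mul_I_ne_zero
      have h1 : (Real.pi : ℂ) ≠ 0 := left_ne_zero_of_mul h0
      field_simp
      ring
    · have h1 := tendsto_deriv_imInfty (fun _ => differentiableAt_eisenE) tendsto_eisenE
      have h2 := h1.sub (((tendsto_eisenE.pow 2).add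
        (((tendsto_thetaX.mul tendsto_thetaY).add (tendsto_thetaY.mul tendsto_thetaW)).add
          (tendsto_thetaW.mul tendsto_thetaX))).const_mul (Real.pi * I / 6 : ℂ))
      simpa using h2
  exact sub_eq_zero.1 (h.eq_zero (by norm_num) hτ)

/-- The defect in the differential equation of `thetaX`. -/
def defectX (τ : ℂ) : ℂ :=
  3 / (Real.pi * I) * (deriv thetaX τ / thetaX τ) - eisenE τ - (thetaW τ - thetaY τ)

/-- The defect in the differential equation of `thetaY`. -/
def defectY (τ : ℂ) : ℂ :=
  3 / (Real.pi * I) * (deriv thetaY τ / thetaY τ) - eisenE τ - (thetaX τ - thetaW τ)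

/-- The defect in the differential equation of `thetaW`. -/
def defectW (τ : ℂ) : ℂ :=
  3 / (Real.pi * I) * (deriv thetaW τ / thetaW τ) - eisenE τ - (thetaY τ - thetaX τ)

theorem defectX_add_one (hτ : 0 < τ.im) : defectX (τ + 1) = defectW τ := by
  rw [defectX, deriv_add_one (g := fun t => -thetaW t) (fun t _ => thetaX_add_one t) hτ,
    deriv.fun_neg, thetaX_add_one, thetaY_add_one, thetaW_add_one, eisenE_add_one hτ, neg_div_neg_eq,
    defectW]
  ring

theorem defectY_add_one (hτ : 0 < τ.im) : defectY (τ + 1) = defectY τ := by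
  rw [defectY, deriv_add_one (g := fun t => -thetaY t) (fun t _ => thetaY_add_one t) hτ,
    deriv.fun_neg, thetaX_add_one, thetaY_add_one, thetaW_add_one, eisenE_add_one hτ, neg_div_neg_eq,
    defectY]
  ring

theorem defectW_add_one (hτ : 0 < τ.im) : defectW (τ + 1) = defectX τ := by
  rw [defectW, deriv_add_one (g := fun t => -thetaX t) (fun t _ => thetaW_add_one t) hτ,
    deriv.fun_neg, thetaX_add_one, thetaY_add_one, thetaW_add_one, eisenE_add_one hτ, neg_div_neg_eq,
    defectX]
  ring

/-- The extra `2 τ`, multiplied by `3 / (π i)`, is the anomaly of `eisenE`; hence the defects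
transform with weight 2. -/
theorem logDeriv_neg_one_div {f g : ℂ → ℂ} (h : ∀ t, 0 < t.im → f (-1 / t) = -t ^ 2 * g t)
    (hf : ∀ t, 0 < t.im → DifferentiableAt ℂ f t) (hg : DifferentiableAt ℂ g τ)
    (hg0 : g τ ≠ 0) (hτ : 0 < τ.im) :
    deriv f (-1 / τ) / f (-1 / τ) = τ ^ 2 * (deriv g τ / g τ) + 2 * τ := by
  have h0 : τ ≠ 0 := fun h => by simp [h] at hτ
  have hd : deriv (fun t => -t ^ 2 * g t) τ = -(2 * τ) * g τ + -τ ^ 2 * deriv g τ := by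
    refine HasDerivAt.deriv ?_
    refine (((hasDerivAt_id τ).fun_pow 2).fun_neg.mul hg.hasDerivAt).congr_deriv ?_
    simp
  rw [deriv_neg_one_div h hf hτ, h τ hτ, hd]
  field_simp
  ring

theorem defectX_neg_one_div (hτ : 0 < τ.im) : defectX (-1 / τ) = τ ^ 2 * defectY τ := by
  rw [defectX, logDeriv_neg_one_div (fun _ => thetaX_neg_one_div) (fun _ => differentiableAt_thetaX)
    (differentiableAt_thetaY hτ) (thetaY_ne_zero hτ) hτ, eisenE_neg_one_div hτ,
    thetaY_neg_one_div hτ, thetaW_neg_one_div hτ, defectY]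
  ring

theorem defectY_neg_one_div (hτ : 0 < τ.im) : defectY (-1 / τ) = τ ^ 2 * defectX τ := by
  rw [defectY, logDeriv_neg_one_div (fun _ => thetaY_neg_one_div) (fun _ => differentiableAt_thetaY)
    (differentiableAt_thetaX hτ) (thetaX_ne_zero hτ) hτ, eisenE_neg_one_div hτ,
    thetaX_neg_one_div hτ, thetaW_neg_one_div hτ, defectX]
  ring

theorem defectW_neg_one_div (hτ : 0 < τ.im) : defectW (-1 / τ) = τ ^ 2 * defectW τ := by
  rw [defectW, logDeriv_neg_one_div (fun _ => thetaW_neg_one_div) (fun _ => differentiableAt_thetaW)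
    (differentiableAt_thetaW hτ) (thetaW_ne_zero hτ) hτ, eisenE_neg_one_div hτ,
    thetaX_neg_one_div hτ, thetaY_neg_one_div hτ, defectW]
  ring

theorem differentiableAt_defect {f : ℂ → ℂ} (hf : ∀ t, 0 < t.im → DifferentiableAt ℂ f t)
    (h0 : f τ ≠ 0) (hτ : 0 < τ.im) (c : ℂ) :
    DifferentiableAt ℂ (fun τ => c * (deriv f τ / f τ) - eisenE τ) τ :=
  (((differentiableAt_deriv_of_im_pos hf hτ).div (hf τ hτ) h0).const_mul _).sub
    (differentiableAt_eisenE hτ)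

theorem differentiableAt_defectX (hτ : 0 < τ.im) : DifferentiableAt ℂ defectX τ :=
  (differentiableAt_defect (fun _ => differentiableAt_thetaX) (thetaX_ne_zero hτ) hτ _).sub
    ((differentiableAt_thetaW hτ).sub (differentiableAt_thetaY hτ))

theorem differentiableAt_defectY (hτ : 0 < τ.im) : DifferentiableAt ℂ defectY τ :=
  (differentiableAt_defect (fun _ => differentiableAt_thetaY) (thetaY_ne_zero hτ) hτ _).sub
    ((differentiableAt_thetaX hτ).sub (differentiableAt_thetaW hτ))

theorem differentiableAt_defectW (hτ : 0 < τ.im) : DifferentiableAt ℂ defectW τ :=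
  (differentiableAt_defect (fun _ => differentiableAt_thetaW) (thetaW_ne_zero hτ) hτ _).sub
    ((differentiableAt_thetaY hτ).sub (differentiableAt_thetaX hτ))

theorem tendsto_defectX : Tendsto defectX imInfty (𝓝 0) := by
  have h1 := tendsto_deriv_imInfty (fun _ => differentiableAt_thetaX) tendsto_thetaX
  have h2 := (((h1.div tendsto_thetaX one_ne_zero).const_mul (3 / (Real.pi * I : ℂ))).sub
    tendsto_eisenE).sub (tendsto_thetaW.sub tendsto_thetaY)
  simpa using! h2

theorem tendsto_defectW : Tendsto defectW imInfty (𝓝 0) := by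
  have h1 := tendsto_deriv_imInfty (fun _ => differentiableAt_thetaW) tendsto_thetaW
  have h2 := (((h1.div tendsto_thetaW (by norm_num)).const_mul (3 / (Real.pi * I : ℂ))).sub
    tendsto_eisenE).sub (tendsto_thetaY.sub tendsto_thetaX)
  simpa using! h2

theorem tendsto_defectY : Tendsto defectY imInfty (𝓝 0) := by
  have h1 := tendsto_deriv_imInfty (fun _ => differentiableAt_thetaYReg) tendsto_thetaYReg
  have h2 := ((((h1.div tendsto_thetaYReg (by norm_num)).add_const (Real.pi * I : ℂ)).const_mul
    (3 / (Real.pi * I : ℂ))).sub tendsto_eisenE).sub (tendsto_thetaX.sub tendsto_thetaW)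
  have h0 := pi_mul_I_ne_zero
  -- Since `thetaY` decays like `16 exp (π i τ)`, its logarithmic derivative tends to `π i`, and the
  -- limit is `3 - 1 - 2 = 0`.
  have e : 3 / (Real.pi * I : ℂ) * (0 / 16 + Real.pi * I) - 1 - (1 - -1) = 0 := by
    rw [zero_div, zero_add, div_mul_cancel₀ _ h0]; norm_num
  rw [e] at h2
  refine h2.congr' ?_
  filter_upwards [eventually_imInfty 0] with t ht
  have hne : thetaYReg t ≠ 0 := mul_ne_zero (thetaY_ne_zero ht) (exp_ne_zero _)
  have hd : HasDerivAt (fun t => thetaYReg t * exp (Real.pi * I * t))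
      (deriv thetaYReg t * exp (Real.pi * I * t) +
        thetaYReg t * (exp (Real.pi * I * t) * (Real.pi * I))) t := by
    refine (differentiableAt_thetaYReg ht).hasDerivAt.mul ?_
    exact ((hasDerivAt_id t).const_mul (Real.pi * I : ℂ)).cexp.congr_deriv (by simp)
  rw [← funext thetaY_eq] at hd
  have e2 : deriv thetaY t / thetaY t = deriv thetaYReg t / thetaYReg t + Real.pi * I := by
    rw [hd.deriv, thetaY_eq]
    have := exp_ne_zero (Real.pi * I * t)
    field_simp
  simp only [defectY, e2, Pi.div_apply]

/-- The generators only permute the defects, so their elementary symmetric functions are cusp forms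
of weights 2, 4 and 6 and vanish. Each defect is a root of the cubic with these coefficients, so its
cube is zero. -/
theorem defect_eq_zero (hτ : 0 < τ.im) : defectX τ = 0 ∧ defectY τ = 0 ∧ defectW τ = 0 := by
  have h1 : IsLevelOneCusp 2 fun τ => defectX τ + defectY τ + defectW τ := by
    refine ⟨fun t ht => ?_, fun t ht => ?_, fun t ht => ?_, ?_⟩
    · exact ((differentiableAt_defectX ht).add (differentiableAt_defectY ht)).add
        (differentiableAt_defectW ht)
    · rw [defectX_add_one ht, defectY_add_one ht, defectW_add_one ht]; ring
    · rw [defectX_neg_one_div ht, defectY_neg_one_div ht, defectW_neg_one_div ht]; ring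
    · simpa using (tendsto_defectX.add tendsto_defectY).add tendsto_defectW
  have h2 : IsLevelOneCusp 4 fun τ =>
      defectX τ * defectY τ + defectY τ * defectW τ + defectW τ * defectX τ := by
    refine ⟨fun t ht => ?_, fun t ht => ?_, fun t ht => ?_, ?_⟩
    · exact (((differentiableAt_defectX ht).mul (differentiableAt_defectY ht)).add
        ((differentiableAt_defectY ht).mul (differentiableAt_defectW ht))).add
        ((differentiableAt_defectW ht).mul (differentiableAt_defectX ht))
    · rw [defectX_add_one ht, defectY_add_one ht, defectW_add_one ht]; ring
    · rw [defectX_neg_one_div ht, defectY_neg_one_div ht, defectW_neg_one_div ht]; ring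
    · simpa using ((tendsto_defectX.mul tendsto_defectY).add
        (tendsto_defectY.mul tendsto_defectW)).add (tendsto_defectW.mul tendsto_defectX)
  have h3 : IsLevelOneCusp 6 fun τ => defectX τ * defectY τ * defectW τ := by
    refine ⟨fun t ht => ?_, fun t ht => ?_, fun t ht => ?_, ?_⟩
    · exact ((differentiableAt_defectX ht).mul (differentiableAt_defectY ht)).mul
        (differentiableAt_defectW ht)
    · rw [defectX_add_one ht, defectY_add_one ht, defectW_add_one ht]; ring
    · rw [defectX_neg_one_div ht, defectY_neg_one_div ht, defectW_neg_one_div ht]; ring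
    · simpa using (tendsto_defectX.mul tendsto_defectY).mul tendsto_defectW
  have e1 := h1.eq_zero (by norm_num) hτ
  have e2 := h2.eq_zero (by norm_num) hτ
  have e3 := h3.eq_zero (by norm_num) hτ
  refine ⟨?_, ?_, ?_⟩
  · exact pow_eq_zero_iff three_ne_zero |>.1
      (by linear_combination defectX τ ^ 2 * e1 - defectX τ * e2 + e3)
  · exact pow_eq_zero_iff three_ne_zero |>.1
      (by linear_combination defectY τ ^ 2 * e1 - defectY τ * e2 + e3)
  · exact pow_eq_zero_iff three_ne_zero |>.1
      (by linear_combination defectW τ ^ 2 * e1 - defectW τ * e2 + e3)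

end ModularIdentities

/-! ### The power series of the theta function and its coefficients -/

section PowerSeries

open Filter Topology

variable {τ : ℂ}

theorem iteratedDeriv_eq_of_hasDerivAt {F : ℕ → ℂ → ℂ} {f : ℂ → ℂ}
    (h0 : ∀ t, 0 < t.im → f t = F 0 t)
    (hF : ∀ k t, 0 < t.im → HasDerivAt (F k) (F (k + 1) t) t) (k : ℕ) (hτ : 0 < τ.im) :
    iteratedDeriv k f τ = F k τ := by
  induction k generalizing τ with
  | zero => rw [iteratedDeriv_zero, h0 τ hτ]
  | succ k ih =>
    rw [iteratedDeriv_succ, ← (hF k τ hτ).deriv]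
    refine EventuallyEq.deriv_eq ?_
    filter_upwards [isOpen_im_pos.mem_nhds hτ] with t ht using ih ht

/-- The series `∑ (-1) ^ n (2 n + 1) ^ j exp ((n + 1 / 2) ^ 2 π i τ)`. -/
def thetaMoment (j : ℕ) (τ : ℂ) : ℂ := halfTheta (fun n => (-1) ^ n * (2 * (n : ℂ) + 1) ^ j) τ

/-- The heat equation: `(n + 1 / 2) ^ 2 π i = (2 n + 1) ^ 2 π i / 4`. -/
theorem hasDerivAt_thetaMoment (j : ℕ) (hτ : 0 < τ.im) :
    HasDerivAt (thetaMoment j) (Real.pi * I / 4 * thetaMoment (j + 2) τ) τ := by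
  refine (hasDerivAt_halfTheta (thetaSummable_odd_pow j) hτ).congr_deriv ?_
  rw [thetaMoment, halfTheta, halfTheta, ← tsum_mul_left]
  exact tsum_congr fun n => by ring

theorem thetaMoment_even {j : ℕ} (hj : Even j) (τ : ℂ) : thetaMoment j τ = 0 := by
  refine halfTheta_reflect (fun n => ?_) τ
  have : (2 * ((-1 - n : ℤ) : ℂ) + 1) = -(2 * n + 1) := by push_cast; ring
  rw [neg_one_zpow_reflect, this, hj.neg_pow, neg_mul]

theorem eta_pow_three_eq (hτ : 0 < τ.im) :
    ModularForm.eta τ ^ 3 = 1 / 2 * thetaMoment 1 τ := by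
  have h := thetaPrime_eq_eta hτ
  have hpi : (Real.pi : ℂ) ≠ 0 := by simp [Real.pi_ne_zero]
  have e : thetaPrime τ = Real.pi * thetaMoment 1 τ := by
    simp only [thetaPrime, thetaMoment, pow_one]
  rw [e] at h
  refine mul_left_cancel₀ hpi ?_
  linear_combination -(1 / 2) * h

theorem iteratedDeriv_eta_eq_thetaMoment (k : ℕ) (hτ : 0 < τ.im) :
    iteratedDeriv k (fun t => ModularForm.eta t ^ 3) τ =
      1 / 2 * (Real.pi * I / 4) ^ k * thetaMoment (2 * k + 1) τ := by
  refine iteratedDeriv_eq_of_hasDerivAt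
    (F := fun k t => 1 / 2 * (Real.pi * I / 4) ^ k * thetaMoment (2 * k + 1) t)
    (fun t ht => ?_) (fun k t ht => ?_) k hτ
  · rw [eta_pow_three_eq ht]
    simp
  · refine ((hasDerivAt_thetaMoment (2 * k + 1) ht).const_mul _).congr_deriv ?_
    rw [show 2 * (k + 1) + 1 = 2 * k + 1 + 2 by ring]
    ring

/-- Summing norms over the power of `z` gives `exp |(2 n + 1) π z|`, of exponent linear in `|n|`;
the Gaussian factor absorbs it. -/
theorem summable_theta1_double (z : ℂ) (hτ : 0 < τ.im) : Summable fun p : ℤ × ℕ =>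
    (-1) ^ p.1 * exp (((p.1 : ℂ) + 1 / 2) ^ 2 * Real.pi * I * τ) *
      (((2 * (p.1 : ℂ) + 1) * Real.pi * I * z) ^ p.2 / p.2.factorial) := by
  rw [← summable_norm_iff]
  have hb : ∀ n : ℤ, ‖(-1) ^ n * exp (((n : ℂ) + 1 / 2) ^ 2 * Real.pi * I * τ)‖ ≤
      Real.exp (-Real.pi * (τ.im * n ^ 2 - 2 * (τ.im / 2) * |n|)) := fun n => by
    rw [norm_mul, norm_zpow, norm_neg, norm_one, one_zpow, one_mul]
    exact norm_exp_half_le hτ n le_rfl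
  have hr : ∀ n : ℤ, ‖(2 * (n : ℂ) + 1) * Real.pi * I * z‖ ≤
      (2 * |(n : ℝ)| + 1) * (Real.pi * ‖z‖) := fun n => by
    have h1 : ‖(2 * (n : ℂ) + 1)‖ = |2 * (n : ℝ) + 1| := by
      rw [← Real.norm_eq_abs, ← Complex.norm_real]; push_cast; rfl
    rw [norm_mul, norm_mul, norm_mul, norm_I, mul_one, h1, Complex.norm_real,
      Real.norm_of_nonneg Real.pi_pos.le, mul_assoc]
    refine mul_le_mul_of_nonneg_right ?_ (by positivity)
    refine (abs_add_le _ _).trans ?_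
    rw [abs_mul, abs_one, abs_two]
  simp only [norm_mul, norm_div, norm_pow]
  rw [summable_prod_of_nonneg (fun p => by positivity)]
  constructor
  · intro n
    have := (Real.summable_pow_div_factorial ‖(2 * (n : ℂ) + 1) * Real.pi * I * z‖).mul_left
      ‖(-1) ^ n * exp (((n : ℂ) + 1 / 2) ^ 2 * Real.pi * I * τ)‖
    simpa only [norm_mul, norm_natCast, norm_zpow] using this
  · have hs := (thetaSummable_one (τ.im / 2 + ‖z‖) τ.im hτ).mul_left (Real.exp (Real.pi * ‖z‖))
    refine Summable.of_nonneg_of_le (fun n => tsum_nonneg fun l => by positivity) (fun n => ?_) hs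
    have e : ∑' l : ℕ, ‖(2 * (n : ℂ) + 1) * Real.pi * I * z‖ ^ l / (l.factorial : ℝ) =
        Real.exp ‖(2 * (n : ℂ) + 1) * Real.pi * I * z‖ := by
      rw [Real.exp_eq_exp_ℝ, NormedSpace.exp_eq_tsum_div]
    simp only [norm_mul, norm_natCast, tsum_mul_left] at e hb hr ⊢
    rw [e, norm_one, one_mul]
    refine (mul_le_mul (hb n) (Real.exp_le_exp.2 (hr n)) (Real.exp_pos _).le
      (Real.exp_pos _).le).trans ?_
    rw [← Real.exp_add, ← Real.exp_add, Real.exp_le_exp]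
    push_cast
    linarith

theorem hasSum_theta1_all (z : ℂ) (hτ : 0 < τ.im) :
    HasSum (fun l : ℕ => -I * ((Real.pi * I * z) ^ l / l.factorial * thetaMoment l τ))
      (theta1 z τ) := by
  have hs := summable_theta1_double z hτ
  have h1 := hs.hasSum.prod_fiberwise fun n => (hs.prod_factor n).hasSum
  have h2 := hs.prod_symm.hasSum.prod_fiberwise fun l => (hs.prod_symm.prod_factor l).hasSum
  have e0 := (Equiv.prodComm ℕ ℤ).tsum_eq fun p : ℤ × ℕ =>
    (-1) ^ p.1 * exp (((p.1 : ℂ) + 1 / 2) ^ 2 * Real.pi * I * τ) *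
      (((2 * (p.1 : ℂ) + 1) * Real.pi * I * z) ^ p.2 / p.2.factorial)
  have e1 : theta1 z τ = -I * ∑' p : ℤ × ℕ,
      (-1) ^ p.1 * exp (((p.1 : ℂ) + 1 / 2) ^ 2 * Real.pi * I * τ) *
      (((2 * (p.1 : ℂ) + 1) * Real.pi * I * z) ^ p.2 / p.2.factorial) := by
    rw [← h1.tsum_eq, theta1, mul_assoc, ← tsum_mul_left]
    congr 1
    refine tsum_congr fun n => ?_
    dsimp only
    have he : ∑' l : ℕ, ((2 * (n : ℂ) + 1) * Real.pi * I * z) ^ l / l.factorial =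
        exp ((2 * (n : ℂ) + 1) * Real.pi * I * z) := by
      rw [Complex.exp_eq_exp_ℂ, NormedSpace.exp_eq_tsum_div]
    rw [tsum_mul_left, he,
      show ((n : ℂ) + 1 / 2) ^ 2 * Real.pi * I * τ =
        Real.pi * I * τ / 4 + ((n : ℂ) ^ 2 + n) * Real.pi * I * τ by ring, exp_add]
    ring
  rw [e1, ← e0]
  have e2 : (fun l : ℕ => -I * ((Real.pi * I * z) ^ l / l.factorial * thetaMoment l τ)) =
      fun l => -I * ∑' n : ℤ, (-1) ^ n * exp (((n : ℂ) + 1 / 2) ^ 2 * Real.pi * I * τ) *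
        (((2 * (n : ℂ) + 1) * Real.pi * I * z) ^ l / l.factorial) := by
    ext l
    rw [thetaMoment, halfTheta, ← tsum_mul_left]
    congr 1
    refine tsum_congr fun n => ?_
    rw [mul_assoc (2 * (n : ℂ) + 1), mul_assoc (2 * (n : ℂ) + 1), mul_pow (2 * (n : ℂ) + 1)]
    ring
  rw [e2]
  exact h2.mul_left (-I)

theorem hasSum_theta1 (z : ℂ) (hτ : 0 < τ.im) :
    HasSum (fun k : ℕ => 2 * Real.pi * ((4 * Real.pi * I) ^ k / ((2 * k + 1).factorial : ℂ) *
      iteratedDeriv k (fun t : ℂ => ModularForm.eta t ^ 3) τ) * z ^ (2 * k + 1))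
      (theta1 z τ) := by
  have hinj : Function.Injective fun k : ℕ => 2 * k + 1 := fun a b h => by simpa using h
  have h := (hinj.hasSum_iff fun l hl => ?_).2 (hasSum_theta1_all z hτ)
  · convert h using 1
    ext k
    rw [iteratedDeriv_eta_eq_thetaMoment k hτ, Function.comp_apply, pow_succ (Real.pi * I * z),
      mul_pow (Real.pi * I) z, pow_mul (Real.pi * I)]
    have e : (4 * Real.pi * I : ℂ) ^ k * (Real.pi * I / 4) ^ k = ((Real.pi * I) ^ 2) ^ k := by
      rw [← mul_pow]
      ring
    rw [← e, pow_succ z]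
    linear_combination (Real.pi * (4 * Real.pi * I) ^ k * (Real.pi * I / 4) ^ k * z ^ (2 * k) * z /
      ((2 * k + 1).factorial : ℂ) * thetaMoment (2 * k + 1) τ) * I_sq
  · have : Even l := by
      rcases Nat.even_or_odd' l with ⟨m, rfl | rfl⟩
      · exact even_two_mul m
      · exact absurd ⟨m, rfl⟩ hl
    rw [thetaMoment_even this, mul_zero, mul_zero]

theorem iteratedDeriv_eta_eq_coeffSum {x y : ℂ → ℂ}
    (hx : ∀ t, 0 < t.im →
      HasDerivAt x (Real.pi * I / 24 * (8 * x t * (eisenE t - x t - 2 * y t))) t)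
    (hy : ∀ t, 0 < t.im →
      HasDerivAt y (Real.pi * I / 24 * (8 * y t * (eisenE t + 2 * x t + y t))) t)
    (hE : ∀ t, 0 < t.im → HasDerivAt eisenE
      (Real.pi * I / 24 * (4 * (eisenE t ^ 2 - (x t ^ 2 + x t * y t + y t ^ 2)))) t)
    (k : ℕ) (hτ : 0 < τ.im) :
    iteratedDeriv k (fun t => ModularForm.eta t ^ 3) τ = ModularForm.eta τ ^ 3 *
      ((Real.pi * I / 24) ^ k * (2 * k + 1).factorial *
        coeffSum k (eisenE τ) (x τ) (y τ)) := by
  refine iteratedDeriv_eq_of_hasDerivAt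
    (F := fun k t => ModularForm.eta t ^ 3 * ((Real.pi * I / 24) ^ k * (2 * k + 1).factorial *
        coeffSum k (eisenE t) (x t) (y t)))
    (fun t ht => ?_) (fun k t ht => ?_) k hτ
  · simp [coeffSum, nTerm, NPoly_zero]
  -- This derivative contributes `π i / 24 · 6 E`, cancelling the negative term in
  -- `hasDerivAt_coeffSum`; the remaining factor `(2 k + 3) (2 k + 2)` advances the factorial.
  · have h1 := (differentiableAt_eta ht).hasDerivAt.fun_pow 3
    rw [deriv_eta ht] at h1
    refine (h1.mul ((hasDerivAt_coeffSum k (hE t ht) (hx t ht) (hy t ht)).const_mul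
      ((Real.pi * I / 24) ^ k * (2 * k + 1).factorial))).congr_deriv ?_
    rw [show 2 * (k + 1) + 1 = 2 * k + 1 + 1 + 1 by ring, Nat.factorial_succ (2 * k + 1 + 1),
      Nat.factorial_succ (2 * k + 1)]
    push_cast
    ring

/-- The constants match because `4 π i · π i / 24 = -π ^ 2 / 6 = -2 · π ^ 2 / 12`, where `π ^ 2 /
12` converts `eisenE` into the Weierstrass eta function. -/
theorem explicitCoeff_eq {N : ℕ → ℂ → ℂ} {x y : ℂ} (k : ℕ) (hτ : 0 < τ.im)
    (hN : ∀ ν, N ν τ = NPoly ν x y) :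
    2 * Real.pi * ((4 * Real.pi * I) ^ k / ((2 * k + 1).factorial : ℂ) *
      (ModularForm.eta τ ^ 3 * ((Real.pi * I / 24) ^ k * (2 * k + 1).factorial *
        coeffSum k (eisenE τ) x y))) = explicitCoeff N k τ := by
  have hf : ((2 * k + 1).factorial : ℂ) ≠ 0 := Nat.cast_ne_zero.2 (Nat.factorial_ne_zero _)
  have e1 : (4 * Real.pi * I) ^ k * (Real.pi * I / 24) ^ k = (-((Real.pi : ℂ) ^ 2 / 6)) ^ k := by
    rw [← mul_pow]
    congr 1
    linear_combination (Real.pi ^ 2 / 6 : ℂ) * I_sq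
  have e2 : (-((Real.pi : ℂ) ^ 2 / 6)) ^ k * coeffSum k (eisenE τ) x y = (-2 : ℂ) ^ k *
      ∑ ν ∈ Finset.range (k + 1), (-((Real.pi : ℂ) ^ 2 / 6)) ^ ν *
      (weierstrassEta τ ^ (k - ν) * N ν τ / ((k - ν).factorial * (2 * ν + 1).factorial)) := by
    rw [coeffSum, ← Finset.Nat.sum_antidiagonal_swap,
      Finset.Nat.sum_antidiagonal_eq_sum_range_succ_mk, Finset.mul_sum, Finset.mul_sum]
    refine Finset.sum_congr rfl fun ν hν => ?_
    obtain ⟨j, rfl⟩ := Nat.exists_eq_add_of_le (Nat.lt_succ_iff.1 (Finset.mem_range.1 hν))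
    rw [hN, weierstrassEta_eq_eisenE hτ, mul_pow]
    have e3 : ((Real.pi : ℂ) ^ 2 / 12) ^ j * (-2) ^ j = (-((Real.pi : ℂ) ^ 2 / 6)) ^ j := by
      rw [← mul_pow]; ring
    simp only [Prod.fst_swap, Prod.snd_swap, add_tsub_cancel_left, nTerm]
    rw [pow_add, pow_add, ← e3]
    ring
  rw [explicitCoeff, ← e2, ← e1]
  field_simp

theorem hasDerivAt_thetaX (hτ : 0 < τ.im) : HasDerivAt thetaX
    (Real.pi * I / 24 * (8 * thetaX τ * (eisenE τ + thetaW τ - thetaY τ))) τ := by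
  refine (differentiableAt_thetaX hτ).hasDerivAt.congr_deriv ?_
  have h := (defect_eq_zero hτ).1
  have h0 := pi_mul_I_ne_zero
  have h1 := thetaX_ne_zero hτ
  rw [defectX, sub_sub, sub_eq_zero, div_mul_div_comm, div_eq_iff (mul_ne_zero h0 h1)] at h
  linear_combination h / 3

theorem hasDerivAt_thetaY (hτ : 0 < τ.im) : HasDerivAt thetaY
    (Real.pi * I / 24 * (8 * thetaY τ * (eisenE τ + thetaX τ - thetaW τ))) τ := by
  refine (differentiableAt_thetaY hτ).hasDerivAt.congr_deriv ?_
  have h := (defect_eq_zero hτ).2.1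
  have h0 := pi_mul_I_ne_zero
  have h1 := thetaY_ne_zero hτ
  rw [defectY, sub_sub, sub_eq_zero, div_mul_div_comm, div_eq_iff (mul_ne_zero h0 h1)] at h
  linear_combination h / 3

theorem hasDerivAt_thetaW (hτ : 0 < τ.im) : HasDerivAt thetaW
    (Real.pi * I / 24 * (8 * thetaW τ * (eisenE τ + thetaY τ - thetaX τ))) τ := by
  refine (differentiableAt_thetaW hτ).hasDerivAt.congr_deriv ?_
  have h := (defect_eq_zero hτ).2.2
  have h0 := pi_mul_I_ne_zero
  have h1 := thetaW_ne_zero hτ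
  rw [defectW, sub_sub, sub_eq_zero, div_mul_div_comm, div_eq_iff (mul_ne_zero h0 h1)] at h
  linear_combination h / 3

theorem hasDerivAt_eisenE (hτ : 0 < τ.im) : HasDerivAt eisenE
    (Real.pi * I / 24 * (4 * (eisenE τ ^ 2 +
      (thetaX τ * thetaY τ + thetaY τ * thetaW τ + thetaW τ * thetaX τ)))) τ := by
  refine (differentiableAt_eisenE hτ).hasDerivAt.congr_deriv ?_
  rw [ramanujan_eisenE hτ]
  ring

/-- Eliminating the third of `X`, `Y`, `W` through their zero sum puts the system into the form
required of `(x, y)`. The other two representations do the same after a cyclic shift. -/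
theorem coeff_eq_N42 (k : ℕ) (hτ : 0 < τ.im) :
    2 * Real.pi * ((4 * Real.pi * I) ^ k / ((2 * k + 1).factorial : ℂ) *
      iteratedDeriv k (fun t : ℂ => ModularForm.eta t ^ 3) τ) = explicitCoeff N42 k τ := by
  have hW : ∀ t : ℂ, 0 < t.im → thetaW t = -thetaX t - thetaY t := fun t ht => by
    linear_combination thetaX_add_thetaY_add_thetaW ht
  rw [iteratedDeriv_eta_eq_coeffSum (x := thetaX) (y := thetaY)
    (fun t ht => (hasDerivAt_thetaX ht).congr_deriv (by rw [hW t ht]; ring))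
    (fun t ht => (hasDerivAt_thetaY ht).congr_deriv (by rw [hW t ht]; ring))
    (fun t ht => (hasDerivAt_eisenE ht).congr_deriv (by rw [hW t ht]; ring)) k hτ]
  exact explicitCoeff_eq k hτ fun ν => N42_eq ν τ

theorem coeff_eq_N34 (k : ℕ) (hτ : 0 < τ.im) :
    2 * Real.pi * ((4 * Real.pi * I) ^ k / ((2 * k + 1).factorial : ℂ) *
      iteratedDeriv k (fun t : ℂ => ModularForm.eta t ^ 3) τ) = explicitCoeff N34 k τ := by
  have hY : ∀ t : ℂ, 0 < t.im → thetaY t = -thetaW t - thetaX t := fun t ht => by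
    linear_combination thetaX_add_thetaY_add_thetaW ht
  rw [iteratedDeriv_eta_eq_coeffSum (x := thetaW) (y := thetaX)
    (fun t ht => (hasDerivAt_thetaW ht).congr_deriv (by rw [hY t ht]; ring))
    (fun t ht => (hasDerivAt_thetaX ht).congr_deriv (by rw [hY t ht]; ring))
    (fun t ht => (hasDerivAt_eisenE ht).congr_deriv (by rw [hY t ht]; ring)) k hτ]
  exact explicitCoeff_eq k hτ fun ν => N34_eq ν τ

theorem coeff_eq_N32 (k : ℕ) (hτ : 0 < τ.im) :
    2 * Real.pi * ((4 * Real.pi * I) ^ k / ((2 * k + 1).factorial : ℂ) *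
      iteratedDeriv k (fun t : ℂ => ModularForm.eta t ^ 3) τ) = explicitCoeff N32 k τ := by
  have hX : ∀ t : ℂ, 0 < t.im → thetaX t = -thetaY t - thetaW t := fun t ht => by
    linear_combination thetaX_add_thetaY_add_thetaW ht
  rw [iteratedDeriv_eta_eq_coeffSum (x := thetaY) (y := thetaW)
    (fun t ht => (hasDerivAt_thetaY ht).congr_deriv (by rw [hX t ht]; ring))
    (fun t ht => (hasDerivAt_thetaW ht).congr_deriv (by rw [hX t ht]; ring))
    (fun t ht => (hasDerivAt_eisenE ht).congr_deriv (by rw [hX t ht]; ring)) k hτ]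
  exact explicitCoeff_eq k hτ fun ν => N32_eq ν τ

theorem explicitCoeff_N42_zero (τ : ℂ) :
    explicitCoeff N42 0 τ = 2 * Real.pi * ModularForm.eta τ ^ 3 := by
  simp [explicitCoeff, N42_eq, NPoly_zero]

theorem explicitCoeff_N42_one (τ : ℂ) : explicitCoeff N42 1 τ =
    2 * Real.pi * ModularForm.eta τ ^ 3 * (-2 * weierstrassEta τ) := by
  simp [explicitCoeff, N42_eq, Finset.sum_range_succ, NPoly_zero, NPoly_one]

theorem explicitCoeff_N42_two (τ : ℂ) : explicitCoeff N42 2 τ =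
    2 * Real.pi * ModularForm.eta τ ^ 3 * (2 * weierstrassEta τ ^ 2 - (Real.pi : ℂ) ^ 4 / 180 *
      (vartheta2 τ ^ 8 + vartheta2 τ ^ 4 * vartheta4 τ ^ 4 + vartheta4 τ ^ 8)) := by
  have h5 : Nat.factorial 5 = 120 := rfl
  simp [explicitCoeff, N42_eq, Finset.sum_range_succ, NPoly_zero, NPoly_one, NPoly_two, h5]
  left
  ring

end PowerSeries

end JacobiPowerSeries

end

open JacobiPowerSeries in
theorem theorem3p6 :
    (∃ C : ℕ → ℂ → ℂ, ∀ τ : ℂ, 0 < τ.im →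
      (∀ z : ℂ, HasSum (fun k : ℕ => C k τ * z ^ (2 * k + 1)) (JacobiPowerSeries.theta1 z τ)) ∧
      C 0 τ = 2 * Real.pi * ModularForm.eta τ ^ 3 ∧
      C 1 τ = 2 * Real.pi * ModularForm.eta τ ^ 3 * (-2 * JacobiPowerSeries.weierstrassEta τ) ∧
      C 2 τ = 2 * Real.pi * ModularForm.eta τ ^ 3 *
        (2 * JacobiPowerSeries.weierstrassEta τ ^ 2 - (Real.pi : ℂ) ^ 4 / 180 *
          (JacobiPowerSeries.vartheta2 τ ^ 8 +
            JacobiPowerSeries.vartheta2 τ ^ 4 * JacobiPowerSeries.vartheta4 τ ^ 4 +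
            JacobiPowerSeries.vartheta4 τ ^ 8)) ∧
      ∀ k : ℕ,
        C k τ = 2 * Real.pi * ((4 * Real.pi * Complex.I) ^ k / ((2 * k + 1).factorial : ℂ) *
          iteratedDeriv k (fun t : ℂ => ModularForm.eta t ^ 3) τ) ∧
        C k τ = JacobiPowerSeries.explicitCoeff JacobiPowerSeries.N42 k τ ∧
        C k τ = JacobiPowerSeries.explicitCoeff JacobiPowerSeries.N34 k τ ∧
        C k τ = JacobiPowerSeries.explicitCoeff JacobiPowerSeries.N32 k τ) ∧
    ∀ m n : ℤ, JacobiPowerSeries.G m n =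
      ((m + n).negOnePow : ℤ) * JacobiPowerSeries.G n m := by
  -- The derivative form serves as `C`; in `ℂ` the unconditional convergence expressed by `HasSum`
  -- is absolute convergence.
  refine ⟨⟨fun k τ => 2 * Real.pi * ((4 * Real.pi * Complex.I) ^ k / ((2 * k + 1).factorial : ℂ) *
    iteratedDeriv k (fun t : ℂ => ModularForm.eta t ^ 3) τ), fun τ hτ =>
    ⟨fun z => hasSum_theta1 z hτ, ?_, ?_, ?_, fun k =>
      ⟨rfl, coeff_eq_N42 k hτ, coeff_eq_N34 k hτ, coeff_eq_N32 k hτ⟩⟩⟩, G_symm⟩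
  · exact (coeff_eq_N42 0 hτ).trans (explicitCoeff_N42_zero τ)
  · exact (coeff_eq_N42 1 hτ).trans (explicitCoeff_N42_one τ)
  · exact (coeff_eq_N42 2 hτ).trans (explicitCoeff_N42_two τ)
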